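/- **Theorem (initialization guarantees in the presence of adversarial outliers).** *Model.* Fix $k\ge 2$, $d$, centroids $\theta_1,\dots,\theta_k\in\mathbb R^d$ with $\Delta=\min_{g\ne h}\|\theta_g-\theta_h\|$ (Euclidean norm), $\sigma>0$, and a decreasing $G:[0,\infty)\to\mathbb R$ with $\lim_{x\to\infty}G(x)=0$; put $G^{-1}(y)=\inf\{x\ge 0: G(x)\le y\}$ for $y>0$. The data consist of $n$ points: points $\theta_{z_i}+w_i$, where the labels $z_i\in[k]$ are fixed and the errors $w_i$ are independent random vectors with $\mathbb P(\|w_i\|>x)\le G(x/\sigma)$ for all $x\ge 0$, and $n^{\mathsf{out}}$ outliers, chosen arbitrarily by an adversary who sees all the $w_i$. Let $n_g^*=|\{i: z_i=g\}|$, so $\sum_{g} n^*_g+n^{\mathsf{out}}=n$. Suppose that $\alpha>0$ and $n_g^*>n\alpha$ for all $g\in[k]$. *Algorithms.* Data sets are counted with multiplicity, all ties are broken arbitrarily, and "the $t$-th smallest" means the $\lceil t\rceil$-th smallest. For a data set $S$ and $q\in(0,1]$, $\mathsf{HDP}_q(S)$ is a point $x\in S$ for which the $|S|q$-th smallest of the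 distances from $x$ to the points of $S$ ($x$ itself included) is minimal. For $\beta\in(0,1)$ let $Q_\beta(x,S)$ be the $(1-\beta)|S|$-th smallest of the distances from $x$ to the points of $S$. For $k\ge2$ and positive integers $m_1,m$, the algorithm $\mathsf{IOD}_{k,m_1,m,\beta}$ on $S$ first computes $\mu_*=\mathsf{HDP}_{m_1/|S|}(S)$. It lets $\mathcal P^{(1)}$ be the $m_1$ points of $S$ closest to $\mu_*$, and obtains $\mathcal P^{(\ell+1)}$ from $\mathcal P^{(\ell)}$ by adding the $m$ points of $\overline{\mathcal P^{(\ell)}}=S\setminus\mathcal P^{(\ell)}$ closest to $\mu_*$ (all of them if fewer than $m$ are left). - If $k=2$: for $1\le\ell\le\lceil(|S|-m_1)/m\rceil-1$ put $\mu_2^{(\ell)}=\mathsf{HDP}_{1-\beta}(\overline{\mathcal P^{(\ell)}})$ and $\mathsf{totdist}^{(\ell)}=Q_\beta(\mu_*,\mathcal P^{(\ell)})+Q_\beta(\mu_2^{(\ell)},\overline{\mathcal P^{(\ell)}})$. For an $\ell$ minimizing $\mathsf{totdist}^{(\ell)}$, output the centroids $(\mu_1^*,\mu_2^*)=(\mu_*,\mu_2^{(\ell)})$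 and the error measure $\mathsf{totdist}^{(\ell)}$. - If $k\ge3$: for $1\le \ell\le\lfloor(|S|-m_1)/m\rfloor$ run $\mathsf{IOD}_{k-1,m_1,m,\beta}$ on $\overline{\mathcal P^{(\ell)}}$, obtaining centroids $\mu_1^{(\ell)},\dots,\mu_{k-1}^{(\ell)}$ and an error measure $\tau^{(\ell)}$, and put $\mathsf{totdist}^{(\ell)}=Q_\beta(\mu_*,\mathcal P^{(\ell)})+\tau^{(\ell)}$. For an $\ell$ minimizing $\mathsf{totdist}^{(\ell)}$, output the centroids $(\mu_1^{(\ell)},\dots,\mu_{k-1}^{(\ell)},\mu_*)$ and $\mathsf{totdist}^{(\ell)}$. A run whose range of $\ell$ is empty has no output; steps $\ell$ whose recursive call has no output are discarded in the minimization, and if no step is left there is no output. *Conclusion.* 1. ($k=2$) There are absolute constants $c_1,c_2>0$ such that, if $n^{\mathsf{out}}\le n\alpha^2/32$ and $\Delta\ge c_1\sigma G^{-1}(e^{-c_2/\alpha^2})$, then with probability at least $1-4e^{-n\alpha/4}$ the algorithm $\mathsf{IOD}_{2,m_1,m,\beta}$ with $m_1=\lceil n\alpha/4\rceil$, $m=\max\{1,\lfloor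 n\alpha^2/16\rfloor\}$, $\beta=\alpha/4$, run on the $n$ data points, has an output, and every possible output satisfies $\max_{i=1,2}\|\theta_{\pi(i)}-\mu_i^*\|\le\Delta/3$ for some permutation $\pi$ of $\{1,2\}$. 2. ($k\ge3$) There are absolute constants $c_1,c_2>0$ such that, for every $k\ge 3$, if $n^{\mathsf{out}}\le n\alpha^2/(64k)$ and $\Delta> c_1k\sigma G^{-1}(e^{-c_2/\beta^2})$ with $\beta=\alpha/(4k)$, then with probability at least $1-2ke^{-n\alpha/4}$ the algorithm $\mathsf{IOD}_{k,m_1,m,\beta}$ with $m_1=\lceil n\alpha/4\rceil$, $m=\max\{1,\lfloor n\beta^2/2\rfloor\}$, run on the $n$ data points, has an output, and every possible output satisfies $\max_{i\in[k]}\|\theta_{\pi(i)}-\mu_i^*\|\le\Delta/3$ for some permutation $\pi$ of $[k]$. -/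

import Mathlib

open MeasureTheory ProbabilityTheory Filter Topology

/-! ### Ordered distances

Data points are a family `Y : ι → E` in a metric space; data sets are given by finite sets of
indices, so that repeated observations are counted with multiplicity. -/

/-- The `t`-th smallest number among the distances `dist x (Y j)`, `j ∈ S` (counted with
multiplicity, for `1 ≤ t ≤ #S`): the least radius `r` such that at least `t` of the points
`Y j`, `j ∈ S`, lie within distance `r` of `x`. -/
noncomputable def kthDist {ι E : Type*} [PseudoMetricSpace E] (Y : ι → E) (S : Finset ι) (x : E)
    (t : ℕ) : ℝ :=
  sInf {r : ℝ | t ≤ (S.filter fun j => dist x (Y j) ≤ r).card}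

/-- `kthDist` is the `t`-th order statistic of the distances: it is at most `r` exactly when at
least `t` of them are at most `r`. -/
theorem kthDist_le_iff {ι E : Type*} [PseudoMetricSpace E] (Y : ι → E) (S : Finset ι) (x : E)
    {t : ℕ} (ht : 1 ≤ t) (htS : t ≤ S.card) (r : ℝ) :
    kthDist Y S x t ≤ r ↔ t ≤ (S.filter fun j => dist x (Y j) ≤ r).card := by
  classical
  set A : Set ℝ := {r : ℝ | t ≤ (S.filter fun j => dist x (Y j) ≤ r).card} with hA
  have hbdd : BddBelow A := by
    refine ⟨0, fun s hs => ?_⟩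
    have hpos : 0 < (S.filter fun j => dist x (Y j) ≤ s).card := lt_of_lt_of_le ht hs
    obtain ⟨j, hj⟩ := Finset.card_pos.mp hpos
    exact dist_nonneg.trans (Finset.mem_filter.mp hj).2
  have hne : A.Nonempty := by
    refine ⟨∑ j ∈ S, dist x (Y j), ?_⟩
    have hfil : (S.filter fun j => dist x (Y j) ≤ ∑ i ∈ S, dist x (Y i)) = S :=
      Finset.filter_true_of_mem fun j hj =>
        Finset.single_le_sum (f := fun i => dist x (Y i)) (fun i _ => dist_nonneg) hj
    show t ≤ (S.filter fun j => dist x (Y j) ≤ ∑ i ∈ S, dist x (Y i)).card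
    rw [hfil]
    exact htS
  constructor
  · intro h
    by_contra hlt
    -- beyond `r` there is a gap up to the next distance, which contradicts the infimum
    set T := S.filter fun j => r < dist x (Y j) with hT
    have hTne : T.Nonempty := by
      by_contra hTe
      rw [Finset.not_nonempty_iff_eq_empty] at hTe
      apply hlt
      have hfil : (S.filter fun j => dist x (Y j) ≤ r) = S := by
        refine Finset.filter_true_of_mem fun j hj => ?_
        by_contra hgt
        have : j ∈ T := Finset.mem_filter.mpr ⟨hj, not_le.mp hgt⟩
        rw [hTe] at this
        simp at this
      rw [hfil]
      exact htS
    obtain ⟨j₀, hj₀, hmin⟩ := Finset.exists_min_image T (fun j => dist x (Y j)) hTne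
    have hlow : dist x (Y j₀) ≤ sInf A := by
      refine le_csInf hne fun s hs => ?_
      by_contra hs'
      apply hlt
      refine le_trans hs (Finset.card_le_card fun j hj => ?_)
      obtain ⟨hjS, hjs⟩ := Finset.mem_filter.mp hj
      refine Finset.mem_filter.mpr ⟨hjS, ?_⟩
      by_contra hgt
      have h1 := hmin j (Finset.mem_filter.mpr ⟨hjS, not_le.mp hgt⟩)
      exact hs' (h1.trans hjs)
    have h2 : r < dist x (Y j₀) := (Finset.mem_filter.mp hj₀).2
    exact absurd (hlow.trans h) (not_le.mpr h2)
  · intro h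
    exact csInf_le hbdd h

/-- The `(1 - β)|S|`-th smallest value (rounded up) among the distances from `x` to the points of
`S`. -/
noncomputable def quantileDist {ι E : Type*} [PseudoMetricSpace E] (Y : ι → E) (β : ℝ)
    (S : Finset ι) (x : E) : ℝ :=
  kthDist Y S x ⌈(1 - β) * (S.card : ℝ)⌉₊

/-! ### The high density point algorithm -/

/-- `i` is a possible output of the High Density Point algorithm with neighbourhood size parameter
`q` on the data set `S`: among all points of `S`, the `⌈|S| q⌉`-th smallest distance to the points
of `S` (the point itself included) is smallest at `Y i`. -/
def IsHDP {ι E : Type*} [PseudoMetricSpace E] (Y : ι → E) (q : ℝ) (S : Finset ι) (i : ι) : Prop :=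
  i ∈ S ∧ ∀ j ∈ S, kthDist Y S (Y i) ⌈(S.card : ℝ) * q⌉₊ ≤ kthDist Y S (Y j) ⌈(S.card : ℝ) * q⌉₊

/-! ### Initialization via Ordered Distances -/

/-- `Q` consists of the first points of `S` in an ordering of `S` by increasing distance from `x`
(ties broken arbitrarily). -/
def IsNearest {ι E : Type*} [PseudoMetricSpace E] (Y : ι → E) (x : E) (S Q : Finset ι) : Prop :=
  Q ⊆ S ∧ ∀ a ∈ Q, ∀ b ∈ S, b ∉ Q → dist x (Y a) ≤ dist x (Y b)

/-- `P 1, P 2, …` are the successive cells produced from the data set `S` with first centroid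
`x`: `P 1` consists of the `m₁` points of `S` nearest to `x`, and at every step the `m` points of
the complement that are nearest to `x` (all of them, if fewer than `m` are left) are moved to the
cell. The complementary cell at step `ℓ` is `S \ P ℓ`. -/
def IsSweep {ι E : Type*} [DecidableEq ι] [PseudoMetricSpace E] (Y : ι → E) (m₁ m : ℕ)
    (S : Finset ι) (x : E) (P : ℕ → Finset ι) : Prop :=
  (P 1).card = m₁ ∧ IsNearest Y x S (P 1) ∧
  ∀ ℓ, 1 ≤ ℓ → ∃ Q : Finset ι, Q.card = min m (S \ P ℓ).card ∧ IsNearest Y x (S \ P ℓ) Q ∧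
    P (ℓ + 1) = P ℓ ∪ Q

/-- `out` is a possible result of the algorithm `IOD_{2,m₁,m,β}` on the data set `S`. A result
`some (c, τ)` consists of the centroids `Y (c 0), Y (c 1)` and the error measure `τ`. The result
is `none` exactly when the range `1, …, ⌈(|S| - m₁) / m⌉ - 1` over which the algorithm minimizes
is empty, i.e. when `|S| ≤ m₁ + m`. -/
def IsIODTwo {ι E : Type*} [DecidableEq ι] [PseudoMetricSpace E] (Y : ι → E) (m₁ m : ℕ) (β : ℝ)
    (S : Finset ι) (out : Option ((Fin 2 → ι) × ℝ)) : Prop :=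
  let L : ℕ := ⌈((S.card : ℝ) - m₁) / m⌉₊ - 1
  (L = 0 ∧ out = none) ∨
  (1 ≤ L ∧ ∃ (i₁ : ι) (P : ℕ → Finset ι) (i₂ : ℕ → ι),
    IsHDP Y ((m₁ : ℝ) / S.card) S i₁ ∧
    IsSweep Y m₁ m S (Y i₁) P ∧
    (∀ ℓ ∈ Finset.Icc 1 L, IsHDP Y (1 - β) (S \ P ℓ) (i₂ ℓ)) ∧
    let totdist : ℕ → ℝ := fun ℓ =>
      quantileDist Y β (P ℓ) (Y i₁) + quantileDist Y β (S \ P ℓ) (Y (i₂ ℓ))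
    ∃ ℓ' ∈ Finset.Icc 1 L, (∀ ℓ ∈ Finset.Icc 1 L, totdist ℓ' ≤ totdist ℓ) ∧
      out = some (![i₁, i₂ ℓ'], totdist ℓ'))

/-- `IsIOD Y m₁ m β k S out`: `out` is a possible result of the recursive algorithm
`IOD_{k,m₁,m,β}` on the data set `S`, for `k ≥ 2`. A result `some (c, τ)` consists of the
centroids `Y (c i)` and the error measure `τ`; the last centroid is the one found at the top
level. A recursive call on a data set with too few points for the algorithm to be run has
result `none`; the corresponding step is discarded in the minimization, and the result is `none`
if no step is left. -/
def IsIOD {ι E : Type*} [DecidableEq ι] [PseudoMetricSpace E] (Y : ι → E) (m₁ m : ℕ) (β : ℝ) :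
    (k : ℕ) → Finset ι → Option ((Fin k → ι) × ℝ) → Prop
  | 0, _, _ => False
  | 1, _, _ => False
  | 2, S, out => IsIODTwo Y m₁ m β S out
  | k + 3, S, out =>
    let L : ℕ := ⌊((S.card : ℝ) - m₁) / m⌋₊
    (L = 0 ∧ out = none) ∨
    (1 ≤ L ∧ ∃ (i₁ : ι) (P : ℕ → Finset ι) (sub : ℕ → Option ((Fin (k + 2) → ι) × ℝ)),
      IsHDP Y ((m₁ : ℝ) / S.card) S i₁ ∧
      IsSweep Y m₁ m S (Y i₁) P ∧
      (∀ ℓ ∈ Finset.Icc 1 L, IsIOD Y m₁ m β (k + 2) (S \ P ℓ) (sub ℓ)) ∧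
      (((∀ ℓ ∈ Finset.Icc 1 L, sub ℓ = none) ∧ out = none) ∨
        ∃ ℓ' ∈ Finset.Icc 1 L, ∃ (c' : Fin (k + 2) → ι) (τ' : ℝ),
          sub ℓ' = some (c', τ') ∧
          (∀ ℓ ∈ Finset.Icc 1 L, ∀ (c'' : Fin (k + 2) → ι) (τ'' : ℝ), sub ℓ = some (c'', τ'') →
            quantileDist Y β (P ℓ') (Y i₁) + τ' ≤ quantileDist Y β (P ℓ) (Y i₁) + τ'') ∧
          out = some (Fin.snoc c' i₁, quantileDist Y β (P ℓ') (Y i₁) + τ')))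

/-! ### The model -/

/-- The minimum separation `Δ = min_{g ≠ h} ‖θ_g - θ_h‖` of the centroids. -/
noncomputable def minSep {k d : ℕ} (θ : Fin k → EuclideanSpace ℝ (Fin d)) : ℝ :=
  ⨅ p : {p : Fin k × Fin k // p.1 ≠ p.2}, ‖θ p.1.1 - θ p.1.2‖

/-- A decay function: decreasing on `[0, ∞)` with limit `0` at infinity. -/
def IsDecayFunction (G : ℝ → ℝ) : Prop :=
  AntitoneOn G (Set.Ici 0) ∧ Tendsto G atTop (𝓝 0)

/-- The (generalized) inverse `G⁻¹(y) = inf {x ≥ 0 : G(x) ≤ y}` of a decay function, `y > 0`. -/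
noncomputable def decayInv (G : ℝ → ℝ) (y : ℝ) : ℝ :=
  sInf {x : ℝ | 0 ≤ x ∧ G x ≤ y}

/-- The errors `w_1, …, w_N` are independent random vectors satisfying the `G`-decay condition
with scale `σ`: `P(‖w_i‖ > x) ≤ G(x / σ)` for all `x ≥ 0`. -/
def IsDecayNoise {Ω : Type*} [MeasurableSpace Ω] (Pr : Measure Ω) {N d : ℕ}
    (w : Fin N → Ω → EuclideanSpace ℝ (Fin d)) (G : ℝ → ℝ) (σ : ℝ) : Prop :=
  (∀ i, Measurable (w i)) ∧ iIndepFun w Pr ∧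
  ∀ i, ∀ x : ℝ, 0 ≤ x → Pr.real {ω | x < ‖w i ω‖} ≤ G (x / σ)

/-- The observed data at the outcome `ω`: the `N` points `θ_{z_i} + w_i` of the mixture model
together with `nout` outliers `a_1, …, a_nout`. -/
def observedData {Ω : Type*} {N nout k d : ℕ} (θ : Fin k → EuclideanSpace ℝ (Fin d))
    (z : Fin N → Fin k) (w : Fin N → Ω → EuclideanSpace ℝ (Fin d))
    (a : Ω → Fin nout → EuclideanSpace ℝ (Fin d)) (ω : Ω) :
    Fin N ⊕ Fin nout → EuclideanSpace ℝ (Fin d) :=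
  Sum.elim (fun i => θ (z i) + w i ω) (a ω)

/-- `IOD_{k,m₁,m,β}`, run on the whole data set `Y`, recovers the centroids `θ`: the algorithm
produces an output, and however the ties in it are broken, the centroids `μ_i = Y (c i)` that it
outputs satisfy `max_i ‖θ_{π(i)} - μ_i‖ ≤ Δ / 3` for some permutation `π`. -/
def IODRecovers {ι : Type*} [Fintype ι] [DecidableEq ι] {k d : ℕ}
    (Y : ι → EuclideanSpace ℝ (Fin d)) (θ : Fin k → EuclideanSpace ℝ (Fin d))
    (m₁ m : ℕ) (β : ℝ) : Prop :=
  (∃ out, IsIOD Y m₁ m β k Finset.univ out) ∧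
  ∀ out, IsIOD Y m₁ m β k Finset.univ out →
    ∃ (c : Fin k → ι) (τ : ℝ), out = some (c, τ) ∧
      ∃ π : Equiv.Perm (Fin k), ∀ i, ‖θ (π i) - Y (c i)‖ ≤ minSep θ / 3

/-! ### Order statistics, high density points and sweeps -/

section OrderStatistics

variable {ι E : Type*} [PseudoMetricSpace E]

/-! The proof separates probability from geometry. A Chernoff bound shows that, except with
probability at most `exp (-N)`, only a small number `s` of errors exceed a radius `r` of the form `σ
* decayInv G (exp (-lam))`. On that event the data are, up to `nout + s` stray points, a union of
clusters `C g` of radius `r` around the `θ g`, and the rest is deterministic.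

Upper bound on the error measure (`IsSweep.exists_step`, `IsIOD.exists_le`). The stray points are
fewer than `m₁`, so the dense ball around the first centroid meets some `C g`. The ball of radius `4
* r` around that centroid then contains `C g` and avoids every other cluster. The last cell of the
sweep inside this ball misses at most `m - 1` of its points, so its complement is again a union of
clusters, one fewer, with at most `m - 1` additional stray points. By induction the recursive call
at this step has error of order `r` times the number of clusters, and hence so does the minimizer,
whichever step it comes from.

From small error to recovery (`IsIOD.exists_cells`, `exists_perm_dist_le_of_cells`). An output with
error `τ` covers the data by cells in which all but a fraction `β` of the points lie within `τ` of
the cell's centroid. If no centroid were within `τ + r` of `θ g`, all of `C g` would lie in the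
trimmed parts, which is impossible since together these contain at most `β * S.card < (C g).card`
points. By separation, different `g` use different centroids, which gives the permutation.

For two clusters the separation hypothesis is not strict and permits `Δ = 0`. Then `r = 0` and the
two true centroids coincide, and `IsIODTwo.dist_eq_zero` shows that both output centroids are exact.
-/

/-- Rank `0` makes the defining set all of `ℝ`, where `sInf` has the default value `0`. Ranks that
round to `0` therefore need no separate hypothesis later. -/
theorem kthDist_zero (Y : ι → E) (S : Finset ι) (x : E) : kthDist Y S x 0 = 0 := by
  simp [kthDist]

theorem kthDist_nonneg (Y : ι → E) (S : Finset ι) (x : E) (t : ℕ) : 0 ≤ kthDist Y S x t := by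
  rcases Nat.eq_zero_or_pos t with rfl | ht
  · rw [kthDist_zero]
  · refine Real.sInf_nonneg fun s hs => ?_
    obtain ⟨j, hj⟩ := Finset.card_pos.mp (lt_of_lt_of_le ht hs)
    exact dist_nonneg.trans (Finset.mem_filter.mp hj).2

theorem kthDist_le_of_le_card (Y : ι → E) (S : Finset ι) (x : E) {t : ℕ} {r : ℝ} (hr : 0 ≤ r)
    (h : t ≤ (S.filter fun j => dist x (Y j) ≤ r).card) : kthDist Y S x t ≤ r := by
  rcases Nat.eq_zero_or_pos t with rfl | ht
  · rwa [kthDist_zero]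
  · exact (kthDist_le_iff Y S x ht (h.trans (Finset.card_filter_le _ _)) r).2 h

theorem le_card_filter_of_kthDist_le (Y : ι → E) (S : Finset ι) (x : E) {t : ℕ} {r : ℝ}
    (ht : t ≤ S.card) (h : kthDist Y S x t ≤ r) :
    t ≤ (S.filter fun j => dist x (Y j) ≤ r).card := by
  rcases Nat.eq_zero_or_pos t with rfl | ht0
  · exact Nat.zero_le _
  · exact (kthDist_le_iff Y S x ht0 ht r).1 h

theorem quantileDist_nonneg (Y : ι → E) (β : ℝ) (S : Finset ι) (x : E) :
    0 ≤ quantileDist Y β S x := kthDist_nonneg _ _ _ _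

theorem ceil_one_sub_mul_card_le {β : ℝ} (hβ : 0 ≤ β) (S : Finset ι) :
    ⌈(1 - β) * (S.card : ℝ)⌉₊ ≤ S.card := by
  refine Nat.ceil_le.2 ?_
  have : (0 : ℝ) ≤ S.card := Nat.cast_nonneg _
  nlinarith

theorem le_card_filter_of_quantileDist_le (Y : ι → E) {β : ℝ} (hβ : 0 ≤ β) (S : Finset ι) (x : E)
    {r : ℝ} (h : quantileDist Y β S x ≤ r) :
    (1 - β) * (S.card : ℝ) ≤ ((S.filter fun j => dist x (Y j) ≤ r).card : ℝ) :=
  Nat.ceil_le.1 (le_card_filter_of_kthDist_le Y S x (ceil_one_sub_mul_card_le hβ S) h)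

theorem quantileDist_le_of_forall (Y : ι → E) {β : ℝ} (hβ : 0 ≤ β) (S : Finset ι) (x : E)
    {r : ℝ} (hr : 0 ≤ r) (h : ∀ j ∈ S, dist x (Y j) ≤ r) : quantileDist Y β S x ≤ r := by
  refine kthDist_le_of_le_card Y S x hr ?_
  rw [Finset.filter_true_of_mem h]
  exact ceil_one_sub_mul_card_le hβ S

theorem IsHDP.exists (Y : ι → E) (q : ℝ) {S : Finset ι} (hS : S.Nonempty) : ∃ i, IsHDP Y q S i :=
  Finset.exists_min_image S (fun i => kthDist Y S (Y i) ⌈(S.card : ℝ) * q⌉₊) hS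

/-- The neighbourhood radius of a high density point is at most the diameter of any sufficiently
large part of the data. -/
theorem IsHDP.kthDist_le {Y : ι → E} {q : ℝ} {S T : Finset ι} {i : ι} {ρ : ℝ} (h : IsHDP Y q S i)
    (hTS : T ⊆ S) (hT : T.Nonempty) (hcard : ⌈(S.card : ℝ) * q⌉₊ ≤ T.card) (hρ : 0 ≤ ρ)
    (hdiam : ∀ a ∈ T, ∀ b ∈ T, dist (Y a) (Y b) ≤ ρ) :
    kthDist Y S (Y i) ⌈(S.card : ℝ) * q⌉₊ ≤ ρ := by
  obtain ⟨a, ha⟩ := hT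
  refine (h.2 a (hTS ha)).trans (kthDist_le_of_le_card Y S (Y a) hρ (hcard.trans ?_))
  exact Finset.card_le_card fun b hb => Finset.mem_filter.2 ⟨hTS hb, hdiam a ha b hb⟩

theorem ceil_card_mul_div (S : Finset ι) (hS : S.Nonempty) (m : ℕ) :
    ⌈(S.card : ℝ) * ((m : ℝ) / S.card)⌉₊ = m := by
  have : (S.card : ℝ) ≠ 0 := by exact_mod_cast hS.card_pos.ne'
  rw [mul_div_cancel₀ _ this, Nat.ceil_natCast]

/-- If the data set has a concentrated part of at least `m` points, then at least `m` points
are close to a high density point. -/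
theorem IsHDP.le_card_filter {Y : ι → E} {m : ℕ} {S T : Finset ι} {i : ι} {ρ : ℝ}
    (h : IsHDP Y ((m : ℝ) / S.card) S i) (hTS : T ⊆ S) (hT : T.Nonempty) (hcard : m ≤ T.card)
    (hρ : 0 ≤ ρ) (hdiam : ∀ a ∈ T, ∀ b ∈ T, dist (Y a) (Y b) ≤ ρ) :
    m ≤ (S.filter fun j => dist (Y i) (Y j) ≤ ρ).card := by
  have hS := ceil_card_mul_div S (hT.mono hTS) m
  have hk := h.kthDist_le hTS hT (by rwa [hS]) hρ hdiam
  rw [hS] at hk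
  exact le_card_filter_of_kthDist_le Y S _ (hcard.trans (Finset.card_le_card hTS)) hk

/-- If all but a fraction `β` of the data set is concentrated, then the `β`-trimmed radius of a
high density point is small. -/
theorem IsHDP.quantileDist_le {Y : ι → E} {β : ℝ} {S T : Finset ι} {i : ι} {ρ : ℝ}
    (h : IsHDP Y (1 - β) S i) (hTS : T ⊆ S) (hT : T.Nonempty)
    (hcard : (1 - β) * (S.card : ℝ) ≤ T.card)
    (hρ : 0 ≤ ρ) (hdiam : ∀ a ∈ T, ∀ b ∈ T, dist (Y a) (Y b) ≤ ρ) :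
    quantileDist Y β S (Y i) ≤ ρ := by
  have := h.kthDist_le hTS hT (Nat.ceil_le.2 (by rwa [mul_comm])) hρ hdiam
  rwa [mul_comm] at this

theorem IsNearest.exists [DecidableEq ι] (Y : ι → E) (x : E) (S : Finset ι) {t : ℕ}
    (ht : t ≤ S.card) : ∃ Q, Q.card = t ∧ IsNearest Y x S Q := by
  induction t with
  | zero => exact ⟨∅, by simp, by simp, by simp⟩
  | succ t ih =>
    obtain ⟨Q, hQc, hQS, hQ⟩ := ih (by omega)
    have hne : (S \ Q).Nonempty := by
      rw [← Finset.card_pos, Finset.card_sdiff_of_subset hQS]; omega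
    obtain ⟨a, ha, hmin⟩ := Finset.exists_min_image (S \ Q) (fun j => dist x (Y j)) hne
    rw [Finset.mem_sdiff] at ha
    refine ⟨insert a Q, by rw [Finset.card_insert_of_notMem ha.2, hQc],
      Finset.insert_subset ha.1 hQS, fun c hc b hb hbQ => ?_⟩
    rw [Finset.mem_insert, not_or] at hbQ
    rcases Finset.mem_insert.1 hc with rfl | hc
    · exact hmin b (Finset.mem_sdiff.2 ⟨hb, hbQ.2⟩)
    · exact hQ c hc b hb hbQ.2

/-- A point of `Q` beyond `ρ` would force every point of `S` within `ρ` into `Q`. By the cardinality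
bound these would already exhaust `Q`. -/
theorem IsNearest.dist_le [DecidableEq ι] {Y : ι → E} {x : E} {S Q : Finset ι} {ρ : ℝ}
    (h : IsNearest Y x S Q)
    (hcard : Q.card ≤ (S.filter fun j => dist x (Y j) ≤ ρ).card) :
    ∀ a ∈ Q, dist x (Y a) ≤ ρ := by
  intro a ha
  by_contra hlt
  set K := S.filter fun j => dist x (Y j) ≤ ρ
  have hne : (K \ Q).Nonempty := by
    rw [Finset.sdiff_nonempty]
    intro hKQ
    have := Finset.eq_of_subset_of_card_le hKQ hcard
    rw [← this] at ha
    exact hlt (Finset.mem_filter.1 ha).2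
  obtain ⟨b, hb⟩ := hne
  rw [Finset.mem_sdiff, Finset.mem_filter] at hb
  exact hlt ((h.2 a ha b hb.1.1 hb.2).trans hb.1.2)

theorem IsSweep.exists [DecidableEq ι] (Y : ι → E) {m₁ : ℕ} (m : ℕ) (S : Finset ι) (x : E)
    (h : m₁ ≤ S.card) : ∃ P, IsSweep Y m₁ m S x P := by
  obtain ⟨P₁, hP₁, hP₁n⟩ := IsNearest.exists Y x S h
  have step : ∀ P : Finset ι, ∃ Q : Finset ι, Q.card = min m (S \ P).card ∧
      IsNearest Y x (S \ P) Q := fun P => IsNearest.exists Y x (S \ P) (min_le_right _ _)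
  choose Q hQ using step
  -- Cells are numbered from `1`, so the recursion runs on `ℓ - 1`.
  let P : ℕ → Finset ι := fun ℓ => Nat.rec P₁ (fun _ R => R ∪ Q R) (ℓ - 1)
  refine ⟨P, hP₁, hP₁n, fun ℓ hℓ => ⟨Q (P ℓ), (hQ _).1, (hQ _).2, ?_⟩⟩
  obtain ⟨t, rfl⟩ : ∃ t, ℓ = t + 1 := ⟨ℓ - 1, by omega⟩
  rfl

theorem IsSweep.isNearest [DecidableEq ι] {Y : ι → E} {m₁ m : ℕ} {S : Finset ι} {x : E}
    {P : ℕ → Finset ι} (h : IsSweep Y m₁ m S x P) {ℓ : ℕ} (hℓ : 1 ≤ ℓ) :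
    IsNearest Y x S (P ℓ) := by
  induction ℓ, hℓ using Nat.le_induction with
  | base => exact h.2.1
  | succ ℓ hℓ ih =>
    obtain ⟨Q, -, hQ, hP⟩ := h.2.2 ℓ hℓ
    rw [hP]
    refine ⟨Finset.union_subset ih.1 (hQ.1.trans Finset.sdiff_subset), fun a ha b hb hbP => ?_⟩
    rw [Finset.mem_union, not_or] at hbP
    rcases Finset.mem_union.1 ha with ha | ha
    · exact ih.2 a ha b hb hbP.1
    · exact hQ.2 a ha b (Finset.mem_sdiff.2 ⟨hb, hbP.1⟩) hbP.2

theorem IsSweep.card_succ [DecidableEq ι] {Y : ι → E} {m₁ m : ℕ} {S : Finset ι} {x : E}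
    {P : ℕ → Finset ι} (h : IsSweep Y m₁ m S x P) (t : ℕ) (ht : m₁ + t * m ≤ S.card) :
    (P (t + 1)).card = m₁ + t * m := by
  induction t with
  | zero => simpa using h.1
  | succ t ih =>
    have hle : m₁ + t * m + m ≤ S.card := by rw [add_assoc, ← Nat.succ_mul]; exact ht
    have ih := ih (by omega)
    obtain ⟨Q, hQc, hQ, hP⟩ := h.2.2 (t + 1) (by omega)
    have hsub := (h.isNearest (ℓ := t + 1) (by omega)).1
    have hdisj : Disjoint (P (t + 1)) Q :=
      Finset.disjoint_left.2 fun a ha haQ => (Finset.mem_sdiff.1 (hQ.1 haQ)).2 ha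
    rw [hP, Finset.card_union_of_disjoint hdisj, hQc, ih, Finset.card_sdiff_of_subset hsub, ih,
      min_eq_left (by omega), Nat.succ_mul, add_assoc]

end OrderStatistics

/-! ### Existence of outputs and the cells behind an output -/

section Outputs

variable {ι E : Type*} [DecidableEq ι] [PseudoMetricSpace E]

/-- Since `P ℓ` has `m₁ + (ℓ - 1) * m` points, an admissible step leaves more than `m` points in the
complement; with the floor, used for three or more clusters, at least `m`. -/
theorem le_ceil_sub_one_iff {s m₁ m ℓ : ℕ} (hm : 1 ≤ m) (hℓ : 1 ≤ ℓ) :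
    ℓ ≤ ⌈((s : ℝ) - m₁) / m⌉₊ - 1 ↔ m₁ + ℓ * m < s := by
  have hm' : (0 : ℝ) < m := by exact_mod_cast hm
  have : ℓ ≤ ⌈((s : ℝ) - m₁) / m⌉₊ - 1 ↔ ℓ < ⌈((s : ℝ) - m₁) / m⌉₊ := by omega
  rw [this, Nat.lt_ceil, lt_div_iff₀ hm', lt_sub_iff_add_lt, add_comm]
  exact_mod_cast Iff.rfl

theorem le_floor_iff_add_mul_le {s m₁ m ℓ : ℕ} (hm : 1 ≤ m) (hℓ : 1 ≤ ℓ) :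
    ℓ ≤ ⌊((s : ℝ) - m₁) / m⌋₊ ↔ m₁ + ℓ * m ≤ s := by
  have hm' : (0 : ℝ) < m := by exact_mod_cast hm
  rw [Nat.le_floor_iff' (by omega), le_div_iff₀ hm', le_sub_iff_add_le, add_comm]
  exact_mod_cast Iff.rfl

theorem IsIODTwo.exists (Y : ι → E) (m₁ : ℕ) {m : ℕ} (hm : 1 ≤ m) (β : ℝ) (S : Finset ι) :
    ∃ out, IsIODTwo Y m₁ m β S out := by
  simp only [IsIODTwo]
  set L := ⌈((S.card : ℝ) - m₁) / m⌉₊ - 1 with hL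
  rcases Nat.eq_zero_or_pos L with h0 | h1
  · exact ⟨none, Or.inl ⟨h0, rfl⟩⟩
  · have h1S := (le_ceil_sub_one_iff hm le_rfl).1 (hL ▸ h1)
    have hS : S.Nonempty := Finset.card_pos.1 (by omega)
    obtain ⟨i₁, hi₁⟩ := IsHDP.exists Y ((m₁ : ℝ) / S.card) hS
    obtain ⟨P, hP⟩ := IsSweep.exists Y m S (Y i₁) (m₁ := m₁) (by omega)
    have hex : ∀ ℓ, ∃ i, ℓ ∈ Finset.Icc 1 L → IsHDP Y (1 - β) (S \ P ℓ) i := by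
      intro ℓ
      by_cases hℓ : ℓ ∈ Finset.Icc 1 L
      · rw [Finset.mem_Icc] at hℓ
        obtain ⟨t, rfl⟩ : ∃ t, ℓ = t + 1 := ⟨ℓ - 1, by omega⟩
        have hlt := (le_ceil_sub_one_iff hm hℓ.1).1 (hL ▸ hℓ.2)
        rw [Nat.succ_mul] at hlt
        have hc := hP.card_succ t (by omega)
        have hne : (S \ P (t + 1)).Nonempty := by
          rw [← Finset.card_pos, Finset.card_sdiff_of_subset (hP.isNearest hℓ.1).1]; omega
        obtain ⟨i, hi⟩ := IsHDP.exists Y (1 - β) hne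
        exact ⟨i, fun _ => hi⟩
      · exact ⟨i₁, fun h => absurd h hℓ⟩
    choose i₂ hi₂ using hex
    obtain ⟨ℓ', hℓ', hmin⟩ := Finset.exists_min_image (Finset.Icc 1 L) (fun ℓ =>
      quantileDist Y β (P ℓ) (Y i₁) + quantileDist Y β (S \ P ℓ) (Y (i₂ ℓ)))
      ⟨1, Finset.mem_Icc.2 ⟨le_rfl, h1⟩⟩
    exact ⟨_, Or.inr ⟨h1, i₁, P, i₂, hi₁, hP, hi₂, ℓ', hℓ', hmin, rfl⟩⟩

theorem IsIOD.exists (Y : ι → E) (m₁ : ℕ) {m : ℕ} (hm : 1 ≤ m) (β : ℝ) (k : ℕ) (S : Finset ι) :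
    ∃ out, IsIOD Y m₁ m β (k + 2) S out := by
  induction k generalizing S with
  | zero => exact IsIODTwo.exists Y m₁ hm β S
  | succ k ih =>
    simp only [IsIOD]
    set L := ⌊((S.card : ℝ) - m₁) / m⌋₊ with hL
    rcases Nat.eq_zero_or_pos L with h0 | h1
    · exact ⟨none, Or.inl ⟨h0, rfl⟩⟩
    have h1S := (le_floor_iff_add_mul_le hm le_rfl).1 (hL ▸ h1)
    have hS : S.Nonempty := Finset.card_pos.1 (by omega)
    obtain ⟨i₁, hi₁⟩ := IsHDP.exists Y ((m₁ : ℝ) / S.card) hS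
    obtain ⟨P, hP⟩ := IsSweep.exists Y m S (Y i₁) (m₁ := m₁) (by omega)
    choose sub hsub using fun ℓ => ih (S \ P ℓ)
    by_cases hnone : ∀ ℓ ∈ Finset.Icc 1 L, sub ℓ = none
    · exact ⟨none, Or.inr ⟨h1, i₁, P, sub, hi₁, hP, fun ℓ _ => hsub ℓ, Or.inl ⟨hnone, rfl⟩⟩⟩
    · push Not at hnone
      obtain ⟨ℓ₀, hℓ₀, hs⟩ := hnone
      -- The minimum is taken only over steps with an output, so the default `0` of `getD` never
      -- enters.
      obtain ⟨ℓ', hℓ', hmin⟩ := Finset.exists_min_image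
        ((Finset.Icc 1 L).filter fun ℓ => (sub ℓ).isSome)
        (fun ℓ => quantileDist Y β (P ℓ) (Y i₁) + ((sub ℓ).map Prod.snd).getD 0)
        ⟨ℓ₀, Finset.mem_filter.2 ⟨hℓ₀, Option.isSome_iff_ne_none.2 hs⟩⟩
      rw [Finset.mem_filter] at hℓ'
      obtain ⟨⟨c', τ'⟩, hc'⟩ := Option.isSome_iff_exists.1 hℓ'.2
      refine ⟨_, Or.inr ⟨h1, i₁, P, sub, hi₁, hP, fun ℓ _ => hsub ℓ, Or.inr ⟨ℓ', hℓ'.1, c', τ', hc',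
        fun ℓ hℓ c'' τ'' h'' => ?_, rfl⟩⟩⟩
      have := hmin ℓ (Finset.mem_filter.2 ⟨hℓ, by simp [h'']⟩)
      simpa [hc', h''] using this

/-- Every output of the algorithm comes with a partition of the data set into cells, such that the
error measure bounds the trimmed radius of every cell. -/
theorem IsIOD.exists_cells {Y : ι → E} {m₁ m : ℕ} {β : ℝ} {k : ℕ} {S : Finset ι}
    {c : Fin (k + 2) → ι} {τ : ℝ} (h : IsIOD Y m₁ m β (k + 2) S (some (c, τ))) :
    ∃ cell : Fin (k + 2) → Finset ι, S ⊆ Finset.univ.biUnion cell ∧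
      ∑ i, (cell i).card ≤ S.card ∧ ∀ i, quantileDist Y β (cell i) (Y (c i)) ≤ τ := by
  induction k generalizing S τ with
  | zero =>
    simp only [IsIOD, IsIODTwo] at h
    rcases h with ⟨-, h⟩ | ⟨-, i₁, P, i₂, -, hP, -, ℓ, hℓ, -, hout⟩
    · simp at h
    rw [Finset.mem_Icc] at hℓ
    have hsub := (hP.isNearest hℓ.1).1
    simp only [Option.some.injEq, Prod.mk.injEq] at hout
    obtain ⟨rfl, rfl⟩ := hout
    refine ⟨![P ℓ, S \ P ℓ], fun j hj => ?_, ?_, fun i => ?_⟩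
    · rw [Finset.mem_biUnion]
      by_cases hjP : j ∈ P ℓ
      · exact ⟨0, Finset.mem_univ _, hjP⟩
      · exact ⟨1, Finset.mem_univ _, Finset.mem_sdiff.2 ⟨hj, hjP⟩⟩
    · have := Finset.card_sdiff_add_card_eq_card hsub
      simp [Fin.sum_univ_two]
      omega
    -- The error measure is a sum of nonnegative terms, hence dominates each of them.
    · have h1 := quantileDist_nonneg Y β (P ℓ) (Y i₁)
      have h2 := quantileDist_nonneg Y β (S \ P ℓ) (Y (i₂ ℓ))
      fin_cases i
      · simpa using h2
      · simpa using h1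
  | succ k ih =>
    simp only [IsIOD] at h
    rcases h with ⟨-, h⟩ | ⟨-, i₁, P, sub, -, hP, hsub, h⟩
    · simp at h
    rcases h with ⟨-, h⟩ | ⟨ℓ, hℓ, c', τ', hc', -, hout⟩
    · simp at h
    have hrec := hsub ℓ hℓ
    rw [hc'] at hrec
    obtain ⟨cell, hcov, hsum, hq⟩ := ih hrec
    simp only [Option.some.injEq, Prod.mk.injEq] at hout
    obtain ⟨rfl, rfl⟩ := hout
    have hPS := (hP.isNearest (Finset.mem_Icc.1 hℓ).1).1
    have hτ : 0 ≤ τ' := (quantileDist_nonneg _ _ _ _).trans (hq 0)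
    refine ⟨Fin.snoc (α := fun _ => Finset ι) cell (P ℓ), fun j hj => ?_, ?_, fun i => ?_⟩
    · rw [Finset.mem_biUnion]
      by_cases hjP : j ∈ P ℓ
      · exact ⟨Fin.last _, Finset.mem_univ _, by simpa using hjP⟩
      · obtain ⟨i, -, hi⟩ := Finset.mem_biUnion.1 (hcov (Finset.mem_sdiff.2 ⟨hj, hjP⟩))
        exact ⟨i.castSucc, Finset.mem_univ _, by simpa using hi⟩
    · have := Finset.card_sdiff_add_card_eq_card hPS
      rw [Fin.sum_univ_castSucc]
      simp only [Fin.snoc_castSucc, Fin.snoc_last]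
      omega
    · have h1 := quantileDist_nonneg Y β (P ℓ) (Y i₁)
      induction i using Fin.lastCases with
      | last => simpa using hτ
      | cast i => simpa using (hq i).trans (le_add_of_nonneg_left h1)

end Outputs

/-! ### Deterministic recovery for nearly clustered data -/

section Recovery

variable {ι κ E : Type*} [DecidableEq ι] [DecidableEq κ] [PseudoMetricSpace E]

/-- In a data set that is, up to `J` points, a union of well separated clusters, the first centroid
lies near one cluster, and one of the cells of the sweep contains that cluster up to fewer than `m`
points, and no point of the other clusters. -/
theorem IsSweep.exists_step {Y : ι → E} {m₁ m J : ℕ} {r : ℝ} {C : κ → Finset ι} {θ : κ → E}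
    {S : Finset ι} {H : Finset κ} {i₁ : ι} {P : ℕ → Finset ι} (hm : 1 ≤ m) (hr : 0 ≤ r)
    (hC : ∀ g, ∀ j ∈ C g, dist (Y j) (θ g) ≤ r)
    (hD : ∀ g h, g ≠ h → 8 * r < dist (θ g) (θ h))
    (hm₁C : ∀ g, m₁ ≤ (C g).card) (hmC : ∀ g, m < (C g).card)
    (hH : H.Nonempty) (hCS : ∀ g ∈ H, C g ⊆ S) (hJ : (S \ H.biUnion C).card ≤ J) (hJm : J < m₁)
    (hi₁ : IsHDP Y ((m₁ : ℝ) / S.card) S i₁) (hP : IsSweep Y m₁ m S (Y i₁) P) :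
    ∃ g ∈ H, ∃ ℓ, 1 ≤ ℓ ∧ ((H.erase g).Nonempty → m₁ + ℓ * m < S.card) ∧
      (∀ j ∈ P ℓ, dist (Y i₁) (Y j) ≤ 4 * r) ∧ (∀ h ∈ H.erase g, C h ⊆ S \ P ℓ) ∧
      ((S \ P ℓ) \ (H.erase g).biUnion C).card ≤ J + (m - 1) := by
  have hdiam : ∀ g, ∀ a ∈ C g, ∀ b ∈ C g, dist (Y a) (Y b) ≤ 2 * r := fun g a ha b hb => by
    have := dist_triangle_right (Y a) (Y b) (θ g)
    linarith [hC g a ha, hC g b hb]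
  obtain ⟨h₀, hh₀⟩ := hH
  have hball := hi₁.le_card_filter (hCS h₀ hh₀) (Finset.card_pos.1 (by have := hmC h₀; omega))
    (hm₁C h₀) (by positivity) (hdiam h₀)
  -- The ball of radius `2 * r` holds at least `m₁ > J` points, too many to be all stray.
  have hg : ∃ g ∈ H, ∃ a ∈ C g, dist (Y i₁) (Y a) ≤ 2 * r := by
    by_contra hcon
    push Not at hcon
    have : (S.filter fun j => dist (Y i₁) (Y j) ≤ 2 * r) ⊆ S \ H.biUnion C := fun j hj => by
      rw [Finset.mem_filter] at hj
      rw [Finset.mem_sdiff, Finset.mem_biUnion]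
      refine ⟨hj.1, ?_⟩
      rintro ⟨g, hgH, hjg⟩
      exact (hcon g hgH j hjg).not_ge hj.2
    have := Finset.card_le_card this
    omega
  obtain ⟨g, hgH, a, ha, hda⟩ := hg
  have hig : dist (Y i₁) (θ g) ≤ 3 * r := by
    have := dist_triangle (Y i₁) (Y a) (θ g)
    linarith [hC g a ha]
  -- The radius `4 * r = 3 * r + r` just suffices to cover `C g`; a point of another cluster is
  -- farther than `8 * r - 3 * r - r = 4 * r`.
  set K := S.filter fun j => dist (Y i₁) (Y j) ≤ 4 * r with hK
  have hCK : C g ⊆ K := fun j hj => by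
    refine Finset.mem_filter.2 ⟨hCS g hgH hj, ?_⟩
    have := dist_triangle_right (Y i₁) (Y j) (θ g)
    linarith [hC g j hj]
  have hfar : ∀ h ∈ H.erase g, ∀ j ∈ C h, 4 * r < dist (Y i₁) (Y j) := fun h hh j hj => by
    have h1 := hD g h (Finset.ne_of_mem_erase hh).symm
    have h2 := dist_triangle4 (θ g) (Y i₁) (Y j) (θ h)
    rw [dist_comm (θ g) (Y i₁)] at h2
    linarith [hC h j hj]
  have hKS : K ⊆ S := Finset.filter_subset _ _
  have hKc := Finset.card_le_card hKS
  have hm₁K : m₁ ≤ K.card := (hm₁C g).trans (Finset.card_le_card hCK)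
  -- The largest number of increments for which the cell is no larger than `K`. Being an initial
  -- segment by distance, the cell then lies inside `K`, and fewer than `m` points of `K` remain
  -- outside.
  obtain ⟨t, ht⟩ : ∃ t, t = (K.card - m₁) / m := ⟨_, rfl⟩
  have hdm := Nat.div_add_mod (K.card - m₁) m
  have hmod := Nat.mod_lt (K.card - m₁) hm
  rw [← ht, mul_comm] at hdm
  have hcard := hP.card_succ t (by omega)
  have hnear := hP.isNearest (ℓ := t + 1) (by omega)
  have hclose := hnear.dist_le (ρ := 4 * r) (by rw [hcard, ← hK]; omega)
  have hPK : P (t + 1) ⊆ K := fun j hj => Finset.mem_filter.2 ⟨hnear.1 hj, hclose j hj⟩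
  refine ⟨g, hgH, t + 1, by omega, ?_, hclose, fun h hh j hj => ?_, ?_⟩
  -- Another cluster, disjoint from `K` and with more than `m` points, leaves room for one further
  -- increment. The strict inequality puts the step in range for both versions of the algorithm.
  · rintro ⟨h, hh⟩
    have hdisj : Disjoint K (C h) := Finset.disjoint_left.2 fun j hjK hjh =>
      (hfar h hh j hjh).not_ge (Finset.mem_filter.1 hjK).2
    have hle := Finset.card_le_card
      (Finset.union_subset hKS (hCS h (Finset.mem_of_mem_erase hh)))
    rw [Finset.card_union_of_disjoint hdisj] at hle
    have := hmC h
    rw [Nat.succ_mul]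
    omega
  · refine Finset.mem_sdiff.2 ⟨hCS h (Finset.mem_of_mem_erase hh) hj, fun hjP => ?_⟩
    exact (hfar h hh j hj).not_ge (hclose j hjP)
  · have hsub : (S \ P (t + 1)) \ (H.erase g).biUnion C ⊆
        (S \ H.biUnion C) ∪ (K \ P (t + 1)) := fun j hj => by
      simp only [Finset.mem_sdiff, Finset.mem_biUnion, not_exists, not_and, Finset.mem_union] at hj ⊢
      by_cases hjg : j ∈ C g
      · exact Or.inr ⟨hCK hjg, hj.1.2⟩
      · refine Or.inl ⟨hj.1.1, fun h hh hjh => ?_⟩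
        rcases eq_or_ne h g with rfl | hne
        · exact hjg hjh
        · exact hj.2 h (Finset.mem_erase.2 ⟨hne, hh⟩) hjh
    have h1 := (Finset.card_le_card hsub).trans (Finset.card_union_le _ _)
    rw [Finset.card_sdiff_of_subset hPK, hcard] at h1
    omega

/-- On a data set which is, up to few points, a union of well separated clusters, the algorithm
has an output, and the error measure of the output is of the order of the cluster radius. -/
theorem IsIOD.exists_le {Y : ι → E} {m₁ m J : ℕ} {β r : ℝ} {C : κ → Finset ι} {θ : κ → E}
    (hm : 1 ≤ m) (hβ : 0 ≤ β) (hr : 0 ≤ r)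
    (hC : ∀ g, ∀ j ∈ C g, dist (Y j) (θ g) ≤ r)
    (hD : ∀ g h, g ≠ h → 8 * r < dist (θ g) (θ h))
    (hm₁C : ∀ g, m₁ ≤ (C g).card) (hmC : ∀ g, m < (C g).card)
    {k : ℕ} {S : Finset ι} {H : Finset κ} (hH : H.card = k + 2)
    (hCS : ∀ g ∈ H, C g ⊆ S) (hJ : (S \ H.biUnion C).card ≤ J)
    (hJm : J + (k + 1) * (m - 1) < m₁)
    (hJβ : ∀ g, ((J + (k + 1) * (m - 1) : ℕ) : ℝ) ≤ β * (C g).card)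
    {out : Option ((Fin (k + 2) → ι) × ℝ)} (hout : IsIOD Y m₁ m β (k + 2) S out) :
    ∃ c τ, out = some (c, τ) ∧ τ ≤ 4 * (k + 2) * r := by
  have hdiam : ∀ g, ∀ a ∈ C g, ∀ b ∈ C g, dist (Y a) (Y b) ≤ 2 * r := fun g a ha b hb => by
    have := dist_triangle_right (Y a) (Y b) (θ g)
    linarith [hC g a ha, hC g b hb]
  have hcardE : ∀ g ∈ H, (H.erase g).card = k + 1 := fun g hg => by
    rw [Finset.card_erase_of_mem hg, hH]; rfl
  have hHne : H.Nonempty := Finset.card_pos.1 (by omega)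
  induction k generalizing S H J with
  | zero =>
    simp only [IsIOD, IsIODTwo] at hout
    set L := ⌈((S.card : ℝ) - m₁) / m⌉₊ - 1 with hL
    have hstep := fun i₁ P => IsSweep.exists_step (i₁ := i₁) (P := P) hm hr hC hD hm₁C hmC hHne hCS
      hJ (lt_of_le_of_lt (Nat.le_add_right _ _) hJm)
    have hmemL : ∀ ℓ, 1 ≤ ℓ → m₁ + ℓ * m < S.card → ℓ ∈ Finset.Icc 1 L := fun ℓ h1 h2 =>
      Finset.mem_Icc.2 ⟨h1, hL ▸ (le_ceil_sub_one_iff hm h1).2 h2⟩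
    rcases hout with ⟨hL0, -⟩ | ⟨-, i₁, P, i₂, hi₁, hP, hi₂, ℓ', -, hmin, rfl⟩
    -- An empty range is impossible: a hypothetical high density point and sweep would have an
    -- admissible step.
    · exfalso
      obtain ⟨h₀, hh₀⟩ := hHne
      have hSne : S.Nonempty := (Finset.card_pos.1 (by have := hmC h₀; omega)).mono (hCS h₀ hh₀)
      obtain ⟨i₁, hi₁⟩ := IsHDP.exists Y ((m₁ : ℝ) / S.card) hSne
      obtain ⟨P, hP⟩ := IsSweep.exists Y m S (Y i₁)
        ((hm₁C h₀).trans (Finset.card_le_card (hCS h₀ hh₀)))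
      obtain ⟨g, hg, ℓ, hℓ1, hℓ, -⟩ := hstep i₁ P hi₁ hP
      have := Finset.mem_Icc.1
        (hmemL ℓ hℓ1 (hℓ (Finset.card_pos.1 (by rw [hcardE g hg]; omega))))
      omega
    · obtain ⟨g, hg, ℓ, hℓ1, hℓ, hclose, hCS', hJ'⟩ := hstep i₁ P hi₁ hP
      obtain ⟨h, hh⟩ := Finset.card_eq_one.1 (hcardE g hg)
      have hℓL := hmemL ℓ hℓ1 (hℓ (by simp [hh]))
      refine ⟨_, _, rfl, (hmin ℓ hℓL).trans ?_⟩
      rw [hh] at hCS' hJ'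
      have hsub := hCS' h (Finset.mem_singleton_self h)
      rw [Finset.singleton_biUnion] at hJ'
      have h1 := quantileDist_le_of_forall Y hβ (P ℓ) (Y i₁) (by positivity) hclose
      -- The complement is the single remaining cluster plus stray points, and these are few enough
      -- to be trimmed away.
      have h2 : quantileDist Y β (S \ P ℓ) (Y (i₂ ℓ)) ≤ 2 * r := by
        refine (hi₂ ℓ hℓL).quantileDist_le hsub (Finset.card_pos.1 (by have := hmC h; omega)) ?_
          (by positivity) (hdiam h)
        have h3 := Finset.card_sdiff_add_card_eq_card hsub
        have h4 : (((S \ P ℓ) \ C h).card : ℝ) ≤ β * (C h).card := by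
          refine le_trans ?_ (hJβ h)
          exact_mod_cast (by simpa using hJ')
        have h5 : ((C h).card : ℝ) ≤ ((S \ P ℓ).card : ℝ) := by
          exact_mod_cast Finset.card_le_card hsub
        have h6 : (((S \ P ℓ) \ C h).card : ℝ) + (C h).card = (S \ P ℓ).card := by
          exact_mod_cast h3
        nlinarith
      push_cast
      linarith
  | succ k ih =>
    simp only [IsIOD] at hout
    set L := ⌊((S.card : ℝ) - m₁) / m⌋₊ with hL
    have hstep := fun i₁ P => IsSweep.exists_step (i₁ := i₁) (P := P) hm hr hC hD hm₁C hmC hHne hCS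
      hJ (lt_of_le_of_lt (Nat.le_add_right _ _) hJm)
    have hmemL : ∀ ℓ, 1 ≤ ℓ → m₁ + ℓ * m < S.card → ℓ ∈ Finset.Icc 1 L := fun ℓ h1 h2 =>
      Finset.mem_Icc.2 ⟨h1, hL ▸ (le_floor_iff_add_mul_le hm h1).2 h2.le⟩
    rcases hout with ⟨hL0, -⟩ | ⟨-, i₁, P, sub, hi₁, hP, hsub, hout⟩
    · exfalso
      obtain ⟨h₀, hh₀⟩ := hHne
      have hSne : S.Nonempty := (Finset.card_pos.1 (by have := hmC h₀; omega)).mono (hCS h₀ hh₀)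
      obtain ⟨i₁, hi₁⟩ := IsHDP.exists Y ((m₁ : ℝ) / S.card) hSne
      obtain ⟨P, hP⟩ := IsSweep.exists Y m S (Y i₁)
        ((hm₁C h₀).trans (Finset.card_le_card (hCS h₀ hh₀)))
      obtain ⟨g, hg, ℓ, hℓ1, hℓ, -⟩ := hstep i₁ P hi₁ hP
      have := Finset.mem_Icc.1
        (hmemL ℓ hℓ1 (hℓ (Finset.card_pos.1 (by rw [hcardE g hg]; omega))))
      omega
    · obtain ⟨g, hg, ℓ, hℓ1, hℓ, hclose, hCS', hJ'⟩ := hstep i₁ P hi₁ hP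
      have hEne : (H.erase g).Nonempty := Finset.card_pos.1 (by rw [hcardE g hg]; omega)
      have hℓL := hmemL ℓ hℓ1 (hℓ hEne)
      -- The `m - 1` points lost at this level come out of the total budget for stray points.
      have hJeq : J + (m - 1) + (k + 1) * (m - 1) = J + (k + 1 + 1) * (m - 1) := by ring
      obtain ⟨c, τ, hc, hτ⟩ := ih (hcardE g hg) hCS' hJ' (by rwa [hJeq]) (by rwa [hJeq])
        (hsub ℓ hℓL) (fun h hh => by rw [Finset.card_erase_of_mem hh, hcardE g hg]; rfl) hEne
      rcases hout with ⟨hnone, -⟩ | ⟨ℓ', -, c', τ', -, hmin, rfl⟩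
      · rw [hnone ℓ hℓL] at hc
        simp at hc
      · refine ⟨_, _, rfl, (hmin ℓ hℓL c τ hc).trans ?_⟩
        have h1 := quantileDist_le_of_forall Y hβ (P ℓ) (Y i₁) (by positivity) hclose
        push_cast
        linarith

/-- If the trimmed radius of every cell is small compared with the separation of the clusters, and
no cluster fits into the trimmed parts of the cells, then the cells match the clusters. -/
theorem exists_perm_dist_le_of_cells {k : ℕ} {Y : ι → E} {β r τ : ℝ}
    {C : Fin k → Finset ι} {θ : Fin k → E} {S : Finset ι} (hβ : 0 ≤ β)
    (hC : ∀ g, ∀ j ∈ C g, dist (Y j) (θ g) ≤ r) (hCS : ∀ g, C g ⊆ S)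
    (hD : ∀ g h, g ≠ h → 2 * (τ + r) < dist (θ g) (θ h))
    (hCβ : ∀ g, β * S.card < (C g).card)
    {c : Fin k → ι} {cell : Fin k → Finset ι} (hcov : S ⊆ Finset.univ.biUnion cell)
    (hsum : ∑ i, (cell i).card ≤ S.card) (hq : ∀ i, quantileDist Y β (cell i) (Y (c i)) ≤ τ) :
    ∃ π : Equiv.Perm (Fin k), ∀ i, dist (θ (π i)) (Y (c i)) ≤ τ + r := by
  have hrep : ∀ g, ∃ i, dist (θ g) (Y (c i)) ≤ τ + r := by
    intro g
    by_contra hcon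
    push Not at hcon
    -- A point of `C g` within `τ` of its cell's centroid would bring that centroid within `τ + r`
    -- of `θ g`.
    have hsub : C g ⊆ Finset.univ.biUnion fun i =>
        (cell i).filter fun j => ¬ dist (Y (c i)) (Y j) ≤ τ := fun j hj => by
      obtain ⟨i, -, hi⟩ := Finset.mem_biUnion.1 (hcov (hCS g hj))
      refine Finset.mem_biUnion.2 ⟨i, Finset.mem_univ _, Finset.mem_filter.2 ⟨hi, fun hle => ?_⟩⟩
      have h1 := hcon i
      have h2 := dist_triangle (Y (c i)) (Y j) (θ g)
      rw [dist_comm (θ g)] at h1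
      linarith [hC g j hj]
    have h1 := (Finset.card_le_card hsub).trans Finset.card_biUnion_le
    have h2 : ∀ i, (((cell i).filter fun j => ¬ dist (Y (c i)) (Y j) ≤ τ).card : ℝ) ≤
        β * (cell i).card := fun i => by
      have h3 := le_card_filter_of_quantileDist_le Y hβ (cell i) (Y (c i)) (hq i)
      have h4 := Finset.card_filter_add_card_filter_not (s := cell i)
        (fun j => dist (Y (c i)) (Y j) ≤ τ)
      have h5 : (((cell i).filter fun j => dist (Y (c i)) (Y j) ≤ τ).card : ℝ) +
        ((cell i).filter fun j => ¬ dist (Y (c i)) (Y j) ≤ τ).card = (cell i).card := by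
        exact_mod_cast h4
      linarith
    have h6 : ((C g).card : ℝ) ≤ β * S.card := calc
      ((C g).card : ℝ) ≤ ∑ i, (((cell i).filter fun j => ¬ dist (Y (c i)) (Y j) ≤ τ).card : ℝ) := by
        exact_mod_cast h1
      _ ≤ ∑ i, β * ((cell i).card : ℝ) := Finset.sum_le_sum fun i _ => h2 i
      _ = β * ((∑ i, (cell i).card : ℕ) : ℝ) := by rw [← Finset.mul_sum]; push_cast; rfl
      _ ≤ β * S.card := by gcongr
    exact (hCβ g).not_ge h6
  choose f hf using hrep
  have hinj : Function.Injective f := fun g h hgh => by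
    by_contra hne
    have h1 := hD g h hne
    have h2 := dist_triangle_right (θ g) (θ h) (Y (c (f g)))
    have h3 := hf g
    have h4 := hf h
    rw [← hgh] at h4
    linarith
  let e := Equiv.ofBijective f ⟨hinj, Finite.surjective_of_injective hinj⟩
  refine ⟨e.symm, fun i => ?_⟩
  have := hf (e.symm i)
  rwa [show f (e.symm i) = i from e.apply_symm_apply i] at this

/-- If all but few points of the data set coincide, then so do the centroids that the algorithm
`IOD_{2,m₁,m,β}` outputs. -/
theorem IsIODTwo.dist_eq_zero {Y : ι → E} {m₁ m b : ℕ} {β : ℝ} {S T : Finset ι} {p : E}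
    (hm : 1 ≤ m) (hβ : 0 ≤ β) (hT : ∀ j ∈ T, dist (Y j) p = 0) (hTS : T ⊆ S)
    (hb : (S \ T).card ≤ b) (hbm₁ : b < m₁) (hmT : m₁ ≤ T.card) (hmS : m₁ + m < S.card)
    (hbβ : (b : ℝ) ≤ β * (S.card - m₁)) (hbm : (b : ℝ) < (1 - β) * (m + 1))
    {out : Option ((Fin 2 → ι) × ℝ)} (hout : IsIODTwo Y m₁ m β S out) :
    ∃ c τ, out = some (c, τ) ∧ ∀ i, dist (Y (c i)) p = 0 := by
  have hdiam : ∀ a ∈ T, ∀ c ∈ T, dist (Y a) (Y c) ≤ 0 := fun a ha c hc => by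
    have := dist_triangle_right (Y a) (Y c) p
    rw [hT a ha, hT c hc] at this
    linarith
  have hTne : T.Nonempty := Finset.card_pos.1 (by omega)
  -- More than `b` points at distance `0` from `x` cannot all avoid `T`, so `x` itself is at
  -- distance `0` from `p`.
  have hmeet : ∀ x : E, ∀ U ⊆ S, b < (U.filter fun j => dist x (Y j) ≤ 0).card →
      dist x p = 0 := fun x U hU hlt => by
    by_contra hne
    have : (U.filter fun j => dist x (Y j) ≤ 0) ⊆ S \ T := fun j hj => by
      rw [Finset.mem_filter] at hj
      refine Finset.mem_sdiff.2 ⟨hU hj.1, fun hjT => hne ?_⟩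
      have := dist_triangle x (Y j) p
      rw [hT j hjT] at this
      exact le_antisymm (by linarith [hj.2]) dist_nonneg
    have := Finset.card_le_card this
    omega
  simp only [IsIODTwo] at hout
  set L := ⌈((S.card : ℝ) - m₁) / m⌉₊ - 1 with hL
  have h1L : 1 ≤ L := hL ▸ (le_ceil_sub_one_iff hm le_rfl).2 (by rwa [one_mul])
  rcases hout with ⟨hL0, -⟩ | ⟨-, i₁, P, i₂, hi₁, hP, hi₂, ℓ', hℓ', hmin, rfl⟩
  · omega
  have hball := hi₁.le_card_filter hTS hTne hmT le_rfl hdiam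
  have hi₁p : dist (Y i₁) p = 0 := hmeet _ S subset_rfl (by omega)
  have hTK : T ⊆ S.filter fun j => dist (Y i₁) (Y j) ≤ 0 := fun j hj => by
    refine Finset.mem_filter.2 ⟨hTS hj, ?_⟩
    have := dist_triangle_right (Y i₁) (Y j) p
    rw [hi₁p, hT j hj] at this
    linarith
  have hP1 := (hP.isNearest le_rfl).dist_le (ρ := 0)
    (by rw [hP.1]; exact hmT.trans (Finset.card_le_card hTK))
  have hq1 := quantileDist_le_of_forall Y hβ (P 1) (Y i₁) le_rfl hP1
  -- Step `1` already has error `0`, so the minimizing step has error `0` as well.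
  have h1mem : 1 ∈ Finset.Icc 1 L := Finset.mem_Icc.2 ⟨le_rfl, h1L⟩
  have hc1 : ((S \ P 1).card : ℝ) = S.card - m₁ := by
    rw [Finset.card_sdiff_of_subset hP.2.1.1, hP.1, Nat.cast_sub (by omega)]
  have hq2 : quantileDist Y β (S \ P 1) (Y (i₂ 1)) ≤ 0 := by
    have hsub : ((S \ P 1) \ T).card ≤ b :=
      (Finset.card_le_card (Finset.sdiff_subset_sdiff Finset.sdiff_subset subset_rfl)).trans hb
    have hle : (((S \ P 1) \ T).card : ℝ) ≤ b := by exact_mod_cast hsub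
    have hadd : (((S \ P 1) \ T).card : ℝ) + ((S \ P 1) ∩ T).card = (S \ P 1).card := by
      exact_mod_cast Finset.card_sdiff_add_card_inter _ _
    have hge : (1 - β) * ((S \ P 1).card : ℝ) ≤ ((S \ P 1) ∩ T).card := by
      rw [← hc1] at hbβ
      linarith
    refine (hi₂ 1 h1mem).quantileDist_le Finset.inter_subset_left ?_ hge le_rfl
      fun a ha c hc => hdiam a (Finset.mem_inter.1 ha).2 c (Finset.mem_inter.1 hc).2
    have hβ1 : 0 < 1 - β := by
      by_contra hcon
      have : (0 : ℝ) ≤ b := Nat.cast_nonneg b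
      nlinarith
    have hpos : (0 : ℝ) < (S \ P 1).card := by
      rw [hc1, sub_pos]
      exact_mod_cast (by omega : m₁ < S.card)
    have : (0 : ℝ) < ((S \ P 1) ∩ T).card := (mul_pos hβ1 hpos).trans_le hge
    exact Finset.card_pos.1 (by exact_mod_cast this)
  have htot := hmin 1 h1mem
  have hn1 := quantileDist_nonneg Y β (P ℓ') (Y i₁)
  have hq' : quantileDist Y β (S \ P ℓ') (Y (i₂ ℓ')) ≤ 0 := by linarith
  have hi₂p : dist (Y (i₂ ℓ')) p = 0 := by
    refine hmeet _ (S \ P ℓ') Finset.sdiff_subset ?_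
    have h1 := le_card_filter_of_quantileDist_le Y hβ _ _ hq'
    rw [Finset.mem_Icc] at hℓ'
    obtain ⟨t, rfl⟩ : ∃ t, ℓ' = t + 1 := ⟨ℓ' - 1, by omega⟩
    have hlt := (le_ceil_sub_one_iff hm hℓ'.1).1 (hL ▸ hℓ'.2)
    rw [Nat.succ_mul] at hlt
    have hc := hP.card_succ t (by omega)
    -- In any admissible complement, `1 - β` of at least `m + 1` points coincide with its centroid;
    -- this exceeds `b`, so `hmeet` applies.
    have hcc : m + 1 ≤ (S \ P (t + 1)).card := by
      rw [Finset.card_sdiff_of_subset (hP.isNearest hℓ'.1).1]; omega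
    have hcc' : (m : ℝ) + 1 ≤ (S \ P (t + 1)).card := by exact_mod_cast hcc
    have hβ1 : 0 ≤ 1 - β := by
      by_contra hcon
      have : (0 : ℝ) ≤ b := Nat.cast_nonneg b
      nlinarith
    have : (b : ℝ) < ((S \ P (t + 1)).filter fun j => dist (Y (i₂ (t + 1))) (Y j) ≤ 0).card :=
      hbm.trans_le ((mul_le_mul_of_nonneg_left hcc' hβ1).trans h1)
    exact_mod_cast this
  refine ⟨_, _, rfl, fun i => ?_⟩
  fin_cases i
  · exact hi₁p
  · exact hi₂p

end Recovery

/-! ### Minimum separation and the generalized inverse -/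

section Separation

theorem minSep_le {k d : ℕ} (θ : Fin k → EuclideanSpace ℝ (Fin d)) {g h : Fin k} (hgh : g ≠ h) :
    minSep θ ≤ dist (θ g) (θ h) := by
  rw [dist_eq_norm]
  exact ciInf_le (f := fun p : {p : Fin k × Fin k // p.1 ≠ p.2} => ‖θ p.1.1 - θ p.1.2‖)
    ⟨0, by rintro _ ⟨p, rfl⟩; exact norm_nonneg _⟩ ⟨(g, h), hgh⟩

theorem minSep_nonneg {k d : ℕ} (θ : Fin k → EuclideanSpace ℝ (Fin d)) : 0 ≤ minSep θ :=
  Real.iInf_nonneg fun _ => norm_nonneg _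

theorem norm_sub_le_minSep_two {d : ℕ} (θ : Fin 2 → EuclideanSpace ℝ (Fin d)) :
    ‖θ 0 - θ 1‖ ≤ minSep θ := by
  have : Nonempty {p : Fin 2 × Fin 2 // p.1 ≠ p.2} := ⟨⟨(0, 1), by decide⟩⟩
  refine le_ciInf ?_
  rintro ⟨⟨g, h⟩, hgh⟩
  fin_cases g <;> fin_cases h
  · simp at hgh
  · exact le_rfl
  · exact (norm_sub_rev _ _).le
  · simp at hgh

theorem decayInv_nonneg (G : ℝ → ℝ) (y : ℝ) : 0 ≤ decayInv G y :=
  Real.sInf_nonneg fun _ hx => hx.1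

theorem le_of_decayInv_lt {G : ℝ → ℝ} (hG : IsDecayFunction G) {y x : ℝ} (hy : 0 < y)
    (hx : decayInv G y < x) : G x ≤ y := by
  have hne : {x : ℝ | 0 ≤ x ∧ G x ≤ y}.Nonempty := by
    obtain ⟨x, hx, hx0⟩ := ((hG.2.eventually (ge_mem_nhds hy)).and (eventually_ge_atTop 0)).exists
    exact ⟨x, hx0, hx⟩
  obtain ⟨s, hs, hsx⟩ := exists_lt_of_csInf_lt hne hx
  exact (hG.1 hs.1 (hs.1.trans hsx.le) hsx.le).trans hs.2

end Separation

/-! ### Tail and Chernoff bounds for the errors -/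

section Noise

variable {Ω : Type*} [MeasurableSpace Ω] {Pr : Measure Ω} [IsProbabilityMeasure Pr] {N d : ℕ}
  {w : Fin N → Ω → EuclideanSpace ℝ (Fin d)} {G : ℝ → ℝ} {σ : ℝ}

/-- The decay condition holds at the generalized inverse itself, by right continuity of the
tail function. -/
theorem IsDecayNoise.tail_le (hw : IsDecayNoise Pr w G σ) (hG : IsDecayFunction G) (hσ : 0 < σ)
    {y : ℝ} (hy : 0 < y) (i : Fin N) : Pr.real {ω | σ * decayInv G y < ‖w i ω‖} ≤ y := by
  set x := decayInv G y
  let u : ℕ → ℝ := fun t => 1 / ((t : ℝ) + 1)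
  have hu : Tendsto u atTop (𝓝 0) := tendsto_one_div_add_atTop_nhds_zero_nat
  -- The infimum defining `decayInv` need not be attained, so the event is exhausted by thresholds
  -- strictly above it.
  have hset : {ω | σ * x < ‖w i ω‖} = ⋃ t, {ω | σ * (x + u t) < ‖w i ω‖} := by
    ext ω
    simp only [Set.mem_ofPred_eq, Set.mem_iUnion]
    refine ⟨fun h => ?_, fun ⟨t, ht⟩ => lt_of_le_of_lt ?_ ht⟩
    · have : Tendsto (fun t => σ * (x + u t)) atTop (𝓝 (σ * (x + 0))) :=
        (hu.const_add x).const_mul σ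
      rw [add_zero] at this
      exact (this.eventually (gt_mem_nhds h)).exists
    · have : 0 ≤ u t := by positivity
      gcongr
      linarith
  have hmono : Monotone fun t => {ω | σ * (x + u t) < ‖w i ω‖} := fun s t hst ω hω => by
    refine lt_of_le_of_lt ?_ (show σ * (x + u s) < ‖w i ω‖ from hω)
    have : u t ≤ u s := Nat.one_div_le_one_div hst
    gcongr
  have hlim := (ENNReal.tendsto_toReal (measure_ne_top Pr _)).comp
    (tendsto_measure_iUnion_atTop (μ := Pr) hmono)
  rw [← hset] at hlim
  refine le_of_tendsto hlim (Eventually.of_forall fun t => ?_)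
  have hpos : 0 < u t := by positivity
  have hx0 : 0 ≤ x := decayInv_nonneg G y
  refine (hw.2.2 i (σ * (x + u t)) (by positivity)).trans ?_
  rw [mul_div_cancel_left₀ _ hσ.ne']
  exact le_of_decayInv_lt hG hy (by linarith)

/-- Chernoff bound for the number of errors that exceed a threshold of tail probability at most
`exp (-lam)`. -/
theorem measure_card_filter_ge_le (hmeas : ∀ i, Measurable (w i)) (hind : iIndepFun w Pr)
    {r lam : ℝ} (hlam : 0 ≤ lam) (htail : ∀ i, Pr.real {ω | r < ‖w i ω‖} ≤ Real.exp (-lam)) (t : ℝ) :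
    Pr.real {ω | t ≤ ((Finset.univ.filter fun i => r < ‖w i ω‖).card : ℝ)} ≤
      Real.exp (N - lam * t) := by
  classical
  let f : EuclideanSpace ℝ (Fin d) → ℝ := Set.indicator {v | r < ‖v‖} 1
  have hset : MeasurableSet {v : EuclideanSpace ℝ (Fin d) | r < ‖v‖} :=
    measurableSet_lt measurable_const measurable_norm
  have hf : Measurable f := measurable_one.indicator hset
  let X : Fin N → Ω → ℝ := fun i => f ∘ w i
  have hX : ∀ i, Measurable (X i) := fun i => hf.comp (hmeas i)
  have hXind : iIndepFun X Pr := hind.comp (fun _ => f) (fun _ => hf)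
  have hsum : ∀ ω, (∑ i, X i) ω = ((Finset.univ.filter fun i => r < ‖w i ω‖).card : ℝ) := by
    intro ω
    simp [X, f, Set.indicator_apply, Finset.sum_boole]
  have hexp : ∀ i ω, Real.exp (lam * X i ω) =
      1 + Set.indicator {ω | r < ‖w i ω‖} (fun _ => Real.exp lam - 1) ω := by
    intro i ω
    by_cases h : r < ‖w i ω‖ <;> simp [X, f, h]
  have hms : ∀ i, MeasurableSet {ω | r < ‖w i ω‖} := fun i => hmeas i hset
  -- The tail bound cancels the exponential weight: the value is at most `1 + exp (-lam) * (exp lam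
  -- - 1) ≤ 2 ≤ exp 1`, whatever `lam` is.
  have hmgf : ∀ i, mgf (X i) Pr lam ≤ Real.exp 1 := by
    intro i
    have h1 : mgf (X i) Pr lam = 1 + Pr.real {ω | r < ‖w i ω‖} * (Real.exp lam - 1) := by
      rw [mgf]
      simp_rw [hexp i]
      rw [integral_add (integrable_const _) ((integrable_const _).indicator (hms i)),
        integral_indicator_const _ (hms i)]
      simp
    have h2 : 1 ≤ Real.exp lam := Real.one_le_exp hlam
    have h3 : Real.exp (-lam) * Real.exp lam = 1 := by rw [← Real.exp_add]; simp
    have h4 : Pr.real {ω | r < ‖w i ω‖} * (Real.exp lam - 1) ≤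
        Real.exp (-lam) * (Real.exp lam - 1) :=
      mul_le_mul_of_nonneg_right (htail i) (by linarith)
    have h5 := Real.add_one_le_exp 1
    have h6 := Real.exp_pos (-lam)
    rw [h1]
    linarith
  have hint : Integrable (fun ω => Real.exp (lam * (∑ i, X i) ω)) Pr := by
    refine Integrable.of_bound (C := Real.exp (lam * N)) ?_ (Eventually.of_forall fun ω => ?_)
    · refine (Real.measurable_exp.comp (Measurable.const_mul ?_ lam)).aestronglyMeasurable
      simp only [Finset.sum_fn]
      exact Finset.measurable_sum _ fun i _ => hX i
    · rw [Real.norm_eq_abs, Real.abs_exp, hsum]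
      refine Real.exp_le_exp.2 (mul_le_mul_of_nonneg_left ?_ hlam)
      have := Finset.card_filter_le (Finset.univ : Finset (Fin N)) fun i => r < ‖w i ω‖
      rw [Finset.card_fin] at this
      exact_mod_cast this
  have hchern := measure_ge_le_exp_mul_mgf t hlam hint
  simp only [hsum] at hchern
  rw [hXind.mgf_sum hX] at hchern
  refine hchern.trans ?_
  calc Real.exp (-lam * t) * ∏ i, mgf (X i) Pr lam
      ≤ Real.exp (-lam * t) * ∏ _i : Fin N, Real.exp 1 := by
        gcongr with i
        · exact fun i _ => mgf_nonneg
        · exact hmgf i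
    _ = Real.exp (N - lam * t) := by
        rw [Finset.prod_const, Finset.card_fin, ← Real.exp_nat_mul, ← Real.exp_add]
        ring_nf

/-- With overwhelming probability only few of the errors are large. -/
theorem IsDecayNoise.exists_few_large (hw : IsDecayNoise Pr w G σ) (hG : IsDecayFunction G)
    (hσ : 0 < σ) {lam t : ℝ} (hlam : 0 ≤ lam) (ht : 2 * N ≤ lam * t) :
    ∃ A : Set Ω, MeasurableSet A ∧ 1 - Real.exp (-N) ≤ Pr.real A ∧ ∀ ω ∈ A,
      ((Finset.univ.filter fun i => σ * decayInv G (Real.exp (-lam)) < ‖w i ω‖).card : ℝ) ≤ t := by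
  classical
  set r := σ * decayInv G (Real.exp (-lam)) with hr
  set B := {ω | t ≤ ((Finset.univ.filter fun i => r < ‖w i ω‖).card : ℝ)} with hB
  have hBm : MeasurableSet B := by
    refine measurableSet_le measurable_const ?_
    have : (fun ω => ((Finset.univ.filter fun i => r < ‖w i ω‖).card : ℝ)) =
        fun ω => ∑ i, Set.indicator {ω | r < ‖w i ω‖} (1 : Ω → ℝ) ω := by
      ext ω
      simp [Set.indicator_apply, Finset.sum_boole]
    rw [this]
    exact Finset.measurable_sum _ fun i _ =>
      measurable_one.indicator (measurableSet_lt measurable_const (hw.1 i).norm)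
  have hle : Pr.real B ≤ Real.exp (-N) :=
    (measure_card_filter_ge_le hw.1 hw.2.1 hlam
      (fun i => hw.tail_le hG hσ (Real.exp_pos _) i) t).trans (Real.exp_le_exp.2 (by linarith))
  refine ⟨Bᶜ, hBm.compl, ?_, fun ω hω => le_of_lt (not_le.1 fun h => hω h)⟩
  rw [probReal_compl_eq_one_sub hBm]
  linarith

end Noise

/-! ### From the mixture model to nearly clustered data -/

section Model

variable {N nout k d : ℕ}

/-- The indices of the regular observations of cluster `g` whose error is at most `r`. -/
noncomputable def inlierCluster (z : Fin N → Fin k) (v : Fin N → EuclideanSpace ℝ (Fin d)) (r : ℝ)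
    (nout : ℕ) (g : Fin k) : Finset (Fin N ⊕ Fin nout) :=
  ((Finset.univ.filter fun i => z i = g).filter fun i => ¬ r < ‖v i‖).map Function.Embedding.inl

theorem mem_inlierCluster {z : Fin N → Fin k} {v : Fin N → EuclideanSpace ℝ (Fin d)} {r : ℝ}
    {g : Fin k} {j : Fin N ⊕ Fin nout} :
    j ∈ inlierCluster z v r nout g ↔ ∃ i, z i = g ∧ ‖v i‖ ≤ r ∧ Sum.inl i = j := by
  simp [inlierCluster, and_assoc]

theorem le_card_inlierCluster_add (z : Fin N → Fin k) (v : Fin N → EuclideanSpace ℝ (Fin d))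
    (r : ℝ) (g : Fin k) :
    (Finset.univ.filter fun i => z i = g).card ≤
      (inlierCluster z v r nout g).card + (Finset.univ.filter fun i => r < ‖v i‖).card := by
  rw [inlierCluster, Finset.card_map, add_comm]
  rw [← Finset.card_filter_add_card_filter_not (s := Finset.univ.filter fun i => z i = g)
    (fun i => r < ‖v i‖)]
  gcongr
  exact Finset.subset_univ _

theorem card_sdiff_biUnion_inlierCluster_le (z : Fin N → Fin k)
    (v : Fin N → EuclideanSpace ℝ (Fin d)) (r : ℝ) :
    (Finset.univ \ Finset.univ.biUnion (inlierCluster z v r nout)).card ≤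
      nout + (Finset.univ.filter fun i => r < ‖v i‖).card := by
  have hsub : Finset.univ \ Finset.univ.biUnion (inlierCluster z v r nout) ⊆
      (Finset.univ : Finset (Fin nout)).map Function.Embedding.inr ∪
        (Finset.univ.filter fun i => r < ‖v i‖).map Function.Embedding.inl := by
    intro j hj
    simp only [Finset.mem_sdiff, Finset.mem_univ, true_and, Finset.mem_biUnion,
      mem_inlierCluster, not_exists, not_and] at hj
    rcases j with i | i
    · have := fun h => hj (z i) i rfl h rfl
      simp only [Finset.mem_union, Finset.mem_map, Finset.mem_filter, Finset.mem_univ, true_and]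
      exact Or.inr ⟨i, not_le.1 this, rfl⟩
    · simp
  have := (Finset.card_le_card hsub).trans (Finset.card_union_le _ _)
  simpa only [Finset.card_map, Finset.card_fin] using this

variable {Ω : Type*} {θ : Fin k → EuclideanSpace ℝ (Fin d)}
  {z : Fin N → Fin k} {w : Fin N → Ω → EuclideanSpace ℝ (Fin d)}
  {a : Ω → Fin nout → EuclideanSpace ℝ (Fin d)} {ω : Ω}

theorem dist_observedData_le {r : ℝ} {g : Fin k} {j : Fin N ⊕ Fin nout}
    (hj : j ∈ inlierCluster z (fun i => w i ω) r nout g) :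
    dist (observedData θ z w a ω j) (θ g) ≤ r := by
  obtain ⟨i, rfl, hi, rfl⟩ := mem_inlierCluster.1 hj
  simpa [observedData, dist_eq_norm] using hi

/-- If the separation is large compared with the radius `r` that all but `s` of the errors observe,
and `s` and the number of outliers are small, then the algorithm recovers the centroids. -/
theorem iodRecovers_of_few_large {K m₁ m s : ℕ} {β r : ℝ}
    {θ : Fin (K + 2) → EuclideanSpace ℝ (Fin d)} {z : Fin N → Fin (K + 2)}
    (hm : 1 ≤ m) (hβ : 0 ≤ β) (hr : 0 ≤ r) (hsep : 100 * (K + 2) * r ≤ minSep θ)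
    (hpos : 0 < minSep θ)
    (hs : (Finset.univ.filter fun i => r < ‖w i ω‖).card ≤ s)
    (hm₁z : ∀ g, m₁ + s ≤ (Finset.univ.filter fun i => z i = g).card)
    (hmz : ∀ g, m + s < (Finset.univ.filter fun i => z i = g).card)
    (hJm : (nout + s) + (K + 1) * (m - 1) < m₁)
    (hJβ : ∀ g, (((nout + s) + (K + 1) * (m - 1) : ℕ) : ℝ) ≤
      β * (((Finset.univ.filter fun i => z i = g).card : ℝ) - s))
    (hzβ : ∀ g, β * (N + nout) + s < ((Finset.univ.filter fun i => z i = g).card : ℝ)) :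
    IODRecovers (observedData θ z w a ω) θ m₁ m β := by
  set Y := observedData θ z w a ω
  set C := inlierCluster z (fun i => w i ω) r nout
  have hCc : ∀ g, (Finset.univ.filter fun i => z i = g).card ≤ (C g).card + s := fun g =>
    (le_card_inlierCluster_add z (fun i => w i ω) r g).trans (Nat.add_le_add_left hs _)
  have hCc' : ∀ g, ((Finset.univ.filter fun i => z i = g).card : ℝ) ≤ (C g).card + s := fun g => by
    exact_mod_cast hCc g
  have hC : ∀ g, ∀ j ∈ C g, dist (Y j) (θ g) ≤ r := fun g j hj => dist_observedData_le hj
  have hKr : 0 ≤ (K : ℝ) * r := by positivity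
  have hD : ∀ g h, g ≠ h → 8 * r < dist (θ g) (θ h) := fun g h hgh => by
    have := minSep_le θ hgh
    linarith
  have hJ := card_sdiff_biUnion_inlierCluster_le (nout := nout) z (fun i => w i ω) r
  refine ⟨IsIOD.exists Y m₁ hm β K _, fun out hout => ?_⟩
  obtain ⟨c, τ, rfl, hτ⟩ := IsIOD.exists_le (C := C) (θ := θ) (r := r) hm hβ hr hC hD
    (fun g => by have := hCc g; have := hm₁z g; omega)
    (fun g => by have := hCc g; have := hmz g; omega)
    (H := Finset.univ) (Finset.card_fin _) (fun _ _ => Finset.subset_univ _)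
    (hJ.trans (Nat.add_le_add_left hs _)) hJm
    (fun g => (hJβ g).trans (mul_le_mul_of_nonneg_left (by linarith [hCc' g]) hβ)) hout
  obtain ⟨cell, hcov, hsum, hq⟩ := hout.exists_cells
  obtain ⟨π, hπ⟩ := exists_perm_dist_le_of_cells (C := C) (θ := θ) (r := r) hβ hC
    (fun _ => Finset.subset_univ _)
    -- Here `τ + r ≤ 5 * (K + 2) * r ≤ minSep θ / 20`. Strictness when `r = 0` comes from `hpos`.
    (fun g h hgh => by
      have := minSep_le θ hgh
      nlinarith)
    (fun g => by
      have h1 := hzβ g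
      have h2 := hCc' g
      rw [Finset.card_univ, Fintype.card_sum, Fintype.card_fin, Fintype.card_fin]
      push_cast
      linarith) hcov hsum hq
  refine ⟨c, τ, rfl, π, fun i => ?_⟩
  have := hπ i
  rw [dist_eq_norm] at this
  linarith

/-- Two coinciding centroids are recovered exactly, if only few of the data points differ from
them. -/
theorem iodRecovers_two_of_minSep_eq_zero {m₁ m s : ℕ} {β : ℝ}
    {θ : Fin 2 → EuclideanSpace ℝ (Fin d)} {z : Fin N → Fin 2}
    (hm : 1 ≤ m) (hβ : 0 ≤ β) (hθ : minSep θ = 0)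
    (hs : (Finset.univ.filter fun i => 0 < ‖w i ω‖).card ≤ s)
    (hm₁z : m₁ + s ≤ (Finset.univ.filter fun i => z i = 0).card)
    (hsm₁ : nout + s < m₁) (hmN : m₁ + m < N + nout)
    (hsβ : ((nout + s : ℕ) : ℝ) ≤ β * (N + nout - m₁))
    (hsm : ((nout + s : ℕ) : ℝ) < (1 - β) * (m + 1)) :
    IODRecovers (observedData θ z w a ω) θ m₁ m β := by
  set Y := observedData θ z w a ω
  set C := inlierCluster z (fun i => w i ω) 0 nout
  have hθ0 : ∀ g, θ g = θ 0 := fun g => by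
    have h1 := norm_sub_le_minSep_two θ
    rw [hθ] at h1
    have h2 := sub_eq_zero.1 (norm_le_zero_iff.1 h1)
    fin_cases g
    · rfl
    · exact h2.symm
  have hcard : (Finset.univ : Finset (Fin N ⊕ Fin nout)).card = N + nout := by
    rw [Finset.card_univ, Fintype.card_sum, Fintype.card_fin, Fintype.card_fin]
  have hT : ∀ j ∈ Finset.univ.biUnion C, dist (Y j) (θ 0) = 0 := fun j hj => by
    obtain ⟨g, -, hg⟩ := Finset.mem_biUnion.1 hj
    rw [← hθ0 g]
    exact le_antisymm (dist_observedData_le hg) dist_nonneg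
  have hJ := card_sdiff_biUnion_inlierCluster_le (nout := nout) z (fun i => w i ω) 0
  have hC0 := Finset.card_le_card (Finset.subset_biUnion_of_mem C (Finset.mem_univ 0))
  have hC0' : (Finset.univ.filter fun i => z i = 0).card ≤
      (C 0).card + (Finset.univ.filter fun i => 0 < ‖w i ω‖).card :=
    le_card_inlierCluster_add z (fun i => w i ω) 0 0
  refine ⟨IsIOD.exists Y m₁ hm β 0 _, fun out hout => ?_⟩
  obtain ⟨c, τ, rfl, hc⟩ := IsIODTwo.dist_eq_zero hm hβ hT (Finset.subset_univ _)
    (hJ.trans (Nat.add_le_add_left hs _)) hsm₁ (by omega) (by rwa [hcard])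
    (by rw [hcard]; exact_mod_cast hsβ) hsm hout
  refine ⟨c, τ, rfl, 1, fun i => ?_⟩
  rw [hθ, hθ0, ← dist_eq_norm, dist_comm, hc i, zero_div]

end Model

/-! ### Numerical choice of parameters and the main theorem -/

section Parameters

/-- Whenever the probability bound is not vacuous, `n * α / 4 > 1`; this absorbs the rounding in
`m₁` and `m`. -/
theorem one_lt_of_exp_neg_lt {x : ℝ} (h : Real.exp (-x) < 1 / 4) : 1 < x := by
  by_contra hx
  have h1 : Real.exp (-1) ≤ Real.exp (-x) := Real.exp_le_exp.2 (by linarith)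
  have := Real.exp_neg_one_gt_d9
  norm_num at this
  linarith

theorem natCast_mul_lt_of_forall_lt_card {N k : ℕ} (hk : 0 < k) {z : Fin N → Fin k} {x : ℝ}
    (h : ∀ g, x < ((Finset.univ.filter fun i => z i = g).card : ℝ)) : k * x < N := by
  have h1 : (N : ℝ) = ∑ g, ((Finset.univ.filter fun i => z i = g).card : ℝ) := by
    have := Finset.card_eq_sum_card_fiberwise (s := (Finset.univ : Finset (Fin N))) (f := z)
      (t := Finset.univ) (fun _ _ => Finset.mem_coe.2 (Finset.mem_univ _))
    rw [Finset.card_fin] at this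
    exact_mod_cast this
  have : Nonempty (Fin k) := ⟨⟨0, hk⟩⟩
  rw [h1]
  calc (k : ℝ) * x = ∑ _g : Fin k, x := by simp
    _ < _ := Finset.sum_lt_sum_of_nonempty Finset.univ_nonempty fun g _ => h g

/-- The loss per level is `m - 1`, which stays below `v` with no rounding error even when `v < 1`
and the maximum is `1`. -/
theorem max_one_floor_bounds {v : ℝ} (hv : 0 ≤ v) :
    ((max 1 ⌊v⌋₊ : ℕ) : ℝ) ≤ 1 + v ∧ ((max 1 ⌊v⌋₊ - 1 : ℕ) : ℝ) ≤ v ∧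
      v < ((max 1 ⌊v⌋₊ : ℕ) : ℝ) + 1 := by
  have h1 := Nat.floor_le hv
  have h2 := Nat.lt_floor_add_one v
  refine ⟨?_, ?_, ?_⟩
  · rw [Nat.cast_max]
    exact max_le (by simpa using hv) (by linarith)
  · refine le_trans (Nat.cast_le.2 (?_ : max 1 ⌊v⌋₊ - 1 ≤ ⌊v⌋₊)) h1
    omega
  · refine h2.trans_le ?_
    gcongr
    exact le_max_right _ _

end Parameters

/-- Recovery of two centroids, with explicit constants. -/
theorem exists_event_iodRecovers_two {d N nout n : ℕ} {α σ Δ : ℝ} {G : ℝ → ℝ}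
    {θ : Fin 2 → EuclideanSpace ℝ (Fin d)} {z : Fin N → Fin 2}
    {Ω : Type*} [MeasurableSpace Ω] {Pr : Measure Ω} [IsProbabilityMeasure Pr]
    {w : Fin N → Ω → EuclideanSpace ℝ (Fin d)}
    {a : Ω → Fin nout → EuclideanSpace ℝ (Fin d)}
    (hn : n = N + nout) (hα : 0 < α)
    (hz : ∀ g, (n : ℝ) * α < ((Finset.univ.filter fun i => z i = g).card : ℝ))
    (hout : (nout : ℝ) ≤ n * α ^ 2 / 32) (hσ : 0 < σ) (hG : IsDecayFunction G)
    (hw : IsDecayNoise Pr w G σ) (hΔ : Δ = minSep θ)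
    (hsep : 200 * σ * decayInv G (Real.exp (-(128 / α ^ 2))) ≤ Δ) :
    ∃ A : Set Ω, MeasurableSet A ∧ 1 - 4 * Real.exp (-(n * α / 4)) ≤ Pr.real A ∧
      ∀ ω ∈ A, IODRecovers (observedData θ z w a ω) θ
        ⌈(n : ℝ) * α / 4⌉₊ (max 1 ⌊(n : ℝ) * α ^ 2 / 16⌋₊) (α / 4) := by
  subst hΔ
  by_cases htriv : 1 ≤ 4 * Real.exp (-(n * α / 4))
  · exact ⟨∅, MeasurableSet.empty, by simpa using htriv, fun ω hω => absurd hω (by simp)⟩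
  have hx4 : 1 < (n : ℝ) * α / 4 := one_lt_of_exp_neg_lt (by linarith)
  have hN := natCast_mul_lt_of_forall_lt_card two_pos hz
  push_cast at hN
  have hnR : (n : ℝ) = N + nout := by exact_mod_cast hn
  have hnout0 : (0 : ℝ) ≤ nout := Nat.cast_nonneg _
  have hn0 : (0 : ℝ) < n := by linarith
  have hα2 : α < 1 / 2 := by nlinarith
  set x : ℝ := n * α with hx
  have hxα : (n : ℝ) * α ^ 2 = x * α := by rw [hx]; ring
  rw [hxα] at hout ⊢
  set y : ℝ := x * α with hy
  have hy0 : 0 < y := by positivity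
  have hyx : y ≤ x / 2 := by nlinarith
  -- The constant `128` makes `lam * t = 2 * n ≥ 2 * N` for `t = y / 64`. Stray points then number
  -- at most `y / 32 + y / 64 + y / 16`, below the trimming allowance of about `y / 4`.
  obtain ⟨A, hA, hPA, hfew⟩ := hw.exists_few_large hG hσ (lam := 128 / α ^ 2) (t := y / 64)
    (by positivity) (by
      have : 128 / α ^ 2 * (y / 64) = 2 * n := by rw [hy, hx]; field_simp; norm_num
      rw [this]
      linarith)
  refine ⟨A, hA, ?_, fun ω hω => ?_⟩
  · have h1 : Real.exp (-(N : ℝ)) ≤ Real.exp (-(x / 4)) := Real.exp_le_exp.2 (by linarith)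
    have h2 := Real.exp_pos (-(x / 4))
    linarith
  set r := σ * decayInv G (Real.exp (-(128 / α ^ 2))) with hr
  have hr0 : 0 ≤ r := mul_nonneg hσ.le (decayInv_nonneg _ _)
  rw [mul_assoc, ← hr] at hsep
  have hs := Nat.le_floor (hfew ω hω)
  have hsR := Nat.floor_le (show 0 ≤ y / 64 by positivity)
  set s := ⌊y / 64⌋₊
  obtain ⟨hmle, hmsub, hmgt⟩ := max_one_floor_bounds (show 0 ≤ y / 16 by positivity)
  have hm1 : 1 ≤ max 1 ⌊y / 16⌋₊ := le_max_left _ _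
  set m := max 1 ⌊y / 16⌋₊
  have hm₁le := Nat.le_ceil (x / 4)
  have hm₁lt := Nat.ceil_lt_add_one (show 0 ≤ x / 4 by linarith)
  set m₁ := ⌈x / 4⌉₊
  -- If `Δ = 0`, the non-strict separation hypothesis forces `r = 0`.
  rcases (minSep_nonneg θ).eq_or_lt with h0 | hpos
  · have hr00 : r = 0 := le_antisymm (by linarith) hr0
    rw [hr00] at hs
    refine iodRecovers_two_of_minSep_eq_zero hm1 (by positivity) h0.symm hs ?_ ?_ ?_ ?_ ?_
    · have : (m₁ : ℝ) + s ≤ ((Finset.univ.filter fun i => z i = 0).card : ℝ) := by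
        linarith [hz 0]
      exact_mod_cast this
    · have : (nout : ℝ) + s < m₁ := by linarith
      exact_mod_cast this
    · have : (m₁ : ℝ) + m < N + nout := by linarith
      exact_mod_cast this
    · have h1 : α / 4 * (n - x / 2) ≤ α / 4 * (N + nout - m₁) :=
        mul_le_mul_of_nonneg_left (by linarith) (by positivity)
      have h2 : α / 4 * (n - x / 2) = x / 4 - y / 8 := by rw [hy, hx]; ring
      push_cast
      linarith
    · push_cast
      nlinarith
  · refine iodRecovers_of_few_large (K := 0) (s := s) hm1 (by positivity) hr0 ?_ hpos hs
      (fun g => ?_) (fun g => ?_) ?_ (fun g => ?_) (fun g => ?_)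
    · push_cast
      linarith
    · have : (m₁ : ℝ) + s ≤ ((Finset.univ.filter fun i => z i = g).card : ℝ) := by
        linarith [hz g]
      exact_mod_cast this
    · have : (m : ℝ) + s < ((Finset.univ.filter fun i => z i = g).card : ℝ) := by
        linarith [hz g]
      exact_mod_cast this
    · have : (nout : ℝ) + s + (0 + 1) * ((m - 1 : ℕ) : ℝ) < m₁ := by linarith
      exact_mod_cast this
    · have h1 : α / 4 * (x * (127 / 128)) ≤
          α / 4 * (((Finset.univ.filter fun i => z i = g).card : ℝ) - s) :=
        mul_le_mul_of_nonneg_left (by linarith [hz g]) (by positivity)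
      have h2 : α / 4 * (x * (127 / 128)) = 127 / 512 * y := by rw [hy]; ring
      push_cast
      linarith
    · have h1 : α / 4 * (N + nout) = x / 4 := by rw [hx, hnR]; ring
      linarith [hz g]

set_option maxHeartbeats 1000000 in
/-- Recovery of at least three centroids, with explicit constants. -/
theorem exists_event_iodRecovers {k d N nout n : ℕ} {α β σ Δ : ℝ} {G : ℝ → ℝ}
    {θ : Fin k → EuclideanSpace ℝ (Fin d)} {z : Fin N → Fin k}
    {Ω : Type*} [MeasurableSpace Ω] {Pr : Measure Ω} [IsProbabilityMeasure Pr]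
    {w : Fin N → Ω → EuclideanSpace ℝ (Fin d)}
    {a : Ω → Fin nout → EuclideanSpace ℝ (Fin d)}
    (hk : 3 ≤ k) (hn : n = N + nout) (hα : 0 < α)
    (hz : ∀ g, (n : ℝ) * α < ((Finset.univ.filter fun i => z i = g).card : ℝ))
    (hout : (nout : ℝ) ≤ n * α ^ 2 / (64 * k)) (hσ : 0 < σ) (hG : IsDecayFunction G)
    (hw : IsDecayNoise Pr w G σ) (hΔ : Δ = minSep θ) (hβ : β = α / (4 * k))
    (hsep : 100 * k * σ * decayInv G (Real.exp (-(2 / β ^ 2))) < Δ) :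
    ∃ A : Set Ω, MeasurableSet A ∧ 1 - 2 * k * Real.exp (-(n * α / 4)) ≤ Pr.real A ∧
      ∀ ω ∈ A, IODRecovers (observedData θ z w a ω) θ
        ⌈(n : ℝ) * α / 4⌉₊ (max 1 ⌊(n : ℝ) * β ^ 2 / 2⌋₊) β := by
  subst hΔ
  obtain ⟨K, rfl⟩ : ∃ K, k = K + 2 := ⟨k - 2, by omega⟩
  by_cases htriv : 1 ≤ 2 * ((K + 2 : ℕ) : ℝ) * Real.exp (-(n * α / 4))
  · exact ⟨∅, MeasurableSet.empty, by simpa using htriv, fun ω hω => absurd hω (by simp)⟩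
  have hq3 : (3 : ℝ) ≤ ((K + 2 : ℕ) : ℝ) := by exact_mod_cast hk
  have hN := natCast_mul_lt_of_forall_lt_card (by omega) hz
  have hqK : ((K + 2 : ℕ) : ℝ) = (K : ℝ) + 2 := by push_cast; rfl
  set q : ℝ := ((K + 2 : ℕ) : ℝ)
  have hx4 : 1 < (n : ℝ) * α / 4 := one_lt_of_exp_neg_lt (by
    have := Real.exp_pos (-((n : ℝ) * α / 4))
    nlinarith)
  have hnR : (n : ℝ) = N + nout := by exact_mod_cast hn
  have hnout0 : (0 : ℝ) ≤ nout := Nat.cast_nonneg _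
  have hβ0 : 0 < β := by rw [hβ]; positivity
  have hαβ : α = 4 * q * β := by rw [hβ]; field_simp
  set x : ℝ := n * α with hx
  have hqx : 3 * x ≤ q * x := by nlinarith
  have hn0 : (0 : ℝ) < n := by linarith
  have hα3 : α < 1 / 3 := by nlinarith
  have hβ1 : β < 1 / 36 := by nlinarith
  -- With `x = 4 * q * u` and `y = u * β`, the size conditions become linear in `x`, `y`, `q * u`
  -- and `q * y`.
  set u : ℝ := n * β with hu
  have hxu : x = 4 * q * u := by rw [hx, hαβ, hu]; ring
  have hyu : (n : ℝ) * β ^ 2 = u * β := by rw [hu]; ring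
  have hout' : (nout : ℝ) ≤ q * (u * β) / 4 := by
    refine hout.trans_eq ?_
    rw [hαβ, hu]
    field_simp
    ring
  rw [hyu]
  have hu0 : 0 < u := by positivity
  set y : ℝ := u * β with hy
  have hy0 : 0 < y := by positivity
  have hyu' : y ≤ u / 36 := by nlinarith
  have hux : 12 * u ≤ x := by rw [hxu]; nlinarith
  have hqy : 3 * y ≤ q * y := mul_le_mul_of_nonneg_right hq3 hy0.le
  have hqyu : q * y ≤ q * u / 36 := by
    rw [mul_div_assoc]
    exact mul_le_mul_of_nonneg_left hyu' (by linarith)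
  obtain ⟨A, hA, hPA, hfew⟩ := hw.exists_few_large hG hσ (lam := 2 / β ^ 2) (t := y)
    (by positivity) (by
      have : 2 / β ^ 2 * y = 2 * n := by rw [hy, hu]; field_simp
      rw [this]
      linarith)
  refine ⟨A, hA, ?_, fun ω hω => ?_⟩
  · have h1 : Real.exp (-(N : ℝ)) ≤ Real.exp (-(x / 4)) := Real.exp_le_exp.2 (by linarith)
    have h2 := Real.exp_pos (-(x / 4))
    have h3 := mul_le_mul_of_nonneg_right hq3 h2.le
    linarith
  set r := σ * decayInv G (Real.exp (-(2 / β ^ 2))) with hr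
  have hr0 : 0 ≤ r := mul_nonneg hσ.le (decayInv_nonneg _ _)
  rw [mul_assoc, ← hr] at hsep
  have hs := Nat.le_floor (hfew ω hω)
  have hsR := Nat.floor_le hy0.le
  set s := ⌊y⌋₊
  obtain ⟨hmle, hmsub, -⟩ := max_one_floor_bounds (show 0 ≤ y / 2 by positivity)
  have hm1 : 1 ≤ max 1 ⌊y / 2⌋₊ := le_max_left _ _
  set m := max 1 ⌊y / 2⌋₊
  have hm₁le := Nat.le_ceil (x / 4)
  have hm₁lt := Nat.ceil_lt_add_one (show 0 ≤ x / 4 by linarith)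
  set m₁ := ⌈x / 4⌉₊
  -- The three contributions are at most `q * y / 4`, `y` and `(q - 1) * y / 2`; their sum is at
  -- most `q * y` because `q ≥ 3`.
  have hJ : (nout : ℝ) + s + (K + 1) * ((m - 1 : ℕ) : ℝ) ≤ q * y := by
    have h1 : ((K : ℝ) + 1) * ((m - 1 : ℕ) : ℝ) ≤ (q - 1) * (y / 2) := by
      rw [show (K : ℝ) + 1 = q - 1 by linarith]
      exact mul_le_mul_of_nonneg_left hmsub (by linarith)
    linarith
  refine iodRecovers_of_few_large (K := K) (s := s) hm1 hβ0.le hr0 ?_ ?_ hs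
    (fun g => ?_) (fun g => ?_) ?_ (fun g => ?_) (fun g => ?_)
  · rw [← hqK]
    exact hsep.le
  · exact lt_of_le_of_lt (by positivity) hsep
  · have : (m₁ : ℝ) + s ≤ ((Finset.univ.filter fun i => z i = g).card : ℝ) := by
      linarith [hz g]
    exact_mod_cast this
  · have : (m : ℝ) + s < ((Finset.univ.filter fun i => z i = g).card : ℝ) := by
      linarith [hz g]
    exact_mod_cast this
  · have hqu : 0 < q * u := by positivity
    have : (nout : ℝ) + s + (K + 1) * ((m - 1 : ℕ) : ℝ) < m₁ := by linarith
    exact_mod_cast this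
  · have h1 : β * (x - y) ≤ β * (((Finset.univ.filter fun i => z i = g).card : ℝ) - s) :=
      mul_le_mul_of_nonneg_left (by linarith [hz g]) hβ0.le
    have h2 : β * (x - y) = 4 * (q * y) - β * y := by rw [hxu, hy]; ring
    have h3 : β * y ≤ y := mul_le_of_le_one_left hy0.le (by linarith)
    push_cast
    linarith
  · have h1 : β * (N + nout) = u := by rw [hu, hnR]; ring
    linarith [hz g]

theorem mainTheorem7 :
    -- two clusters
    (∃ c₁ : ℝ, 0 < c₁ ∧ ∃ c₂ : ℝ, 0 < c₂ ∧
      ∀ (d N nout n : ℕ) (α σ Δ : ℝ) (G : ℝ → ℝ)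
        (θ : Fin 2 → EuclideanSpace ℝ (Fin d)) (z : Fin N → Fin 2)
        (Ω : Type*) [MeasurableSpace Ω] (Pr : Measure Ω) [IsProbabilityMeasure Pr]
        (w : Fin N → Ω → EuclideanSpace ℝ (Fin d))
        (a : Ω → Fin nout → EuclideanSpace ℝ (Fin d)),
        n = N + nout →
        0 < α → (∀ g, (n : ℝ) * α < ((Finset.univ.filter fun i => z i = g).card : ℝ)) →
        (nout : ℝ) ≤ n * α ^ 2 / 32 →
        0 < σ → IsDecayFunction G → IsDecayNoise Pr w G σ →
        Δ = minSep θ →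
        c₁ * σ * decayInv G (Real.exp (-(c₂ / α ^ 2))) ≤ Δ →
        ∃ A : Set Ω, MeasurableSet A ∧ 1 - 4 * Real.exp (-(n * α / 4)) ≤ Pr.real A ∧
          ∀ ω ∈ A, IODRecovers (observedData θ z w a ω) θ
            ⌈(n : ℝ) * α / 4⌉₊ (max 1 ⌊(n : ℝ) * α ^ 2 / 16⌋₊) (α / 4)) ∧
    -- at least three clusters
    (∃ c₁ : ℝ, 0 < c₁ ∧ ∃ c₂ : ℝ, 0 < c₂ ∧
      ∀ (k d N nout n : ℕ) (α β σ Δ : ℝ) (G : ℝ → ℝ)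
        (θ : Fin k → EuclideanSpace ℝ (Fin d)) (z : Fin N → Fin k)
        (Ω : Type*) [MeasurableSpace Ω] (Pr : Measure Ω) [IsProbabilityMeasure Pr]
        (w : Fin N → Ω → EuclideanSpace ℝ (Fin d))
        (a : Ω → Fin nout → EuclideanSpace ℝ (Fin d)),
        3 ≤ k → n = N + nout →
        0 < α → (∀ g, (n : ℝ) * α < ((Finset.univ.filter fun i => z i = g).card : ℝ)) →
        (nout : ℝ) ≤ n * α ^ 2 / (64 * k) →
        0 < σ → IsDecayFunction G → IsDecayNoise Pr w G σ →
        Δ = minSep θ → β = α / (4 * k) →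
        c₁ * k * σ * decayInv G (Real.exp (-(c₂ / β ^ 2))) < Δ →
        ∃ A : Set Ω, MeasurableSet A ∧ 1 - 2 * k * Real.exp (-(n * α / 4)) ≤ Pr.real A ∧
          ∀ ω ∈ A, IODRecovers (observedData θ z w a ω) θ
            ⌈(n : ℝ) * α / 4⌉₊ (max 1 ⌊(n : ℝ) * β ^ 2 / 2⌋₊) β) := by

  -- Both separation constants are `100` per cluster, so `200` for two clusters.
  refine ⟨⟨200, by norm_num, 128, by norm_num, ?_⟩, ⟨100, by norm_num, 2, by norm_num, ?_⟩⟩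
  · intro d N nout n α σ Δ G θ z Ω _ Pr _ w a
    exact exists_event_iodRecovers_two
  · intro k d N nout n α β σ Δ G θ z Ω _ Pr _ w a
    exact exists_event_iodRecovers
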